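/- **Conventions.** For $K=\mathbb R$ or $\mathbb C$ let $K(\!(\tfrac1v)\!)^c$ be the field of Laurent series in $1/v$ over $K$ which converge on some punctured disk of positive radius in $w=1/v$. A *polynomial phase function* is (the germ at $v\to+\infty$ of) a continuous real function $\phi$ such that, for some $0\ne f\in\mathbb C(\!(\tfrac1v)\!)^c$, $f(v)\in\mathbb R_{>0}e^{i\pi\phi(v)}$ for $v\gg0$. Write $\phi_1\prec\phi_2$ (resp. $\phi_1\preceq\phi_2$) if $\phi_1(v)<\phi_2(v)$ (resp. $\le$) for $v\gg0$. Let $\mathcal A$ be the heart of a bounded t-structure on a triangulated category $\mathcal D$, with Grothendieck group $K(\mathcal D)$, and let $\phi_0$ be a polynomial phase function. A homomorphism $Z:K(\mathcal D)\to\mathbb C(\!(\tfrac1v)\!)^c$ is a *weak polynomial stability function* on $\mathcal A$ with respect to $(\phi_0,\phi_0+1]$ if $Z(E)(v)\in\mathbb R_{\ge0}\,e^{i\pi(\phi_0(v),\phi_0(v)+1]}$ for $v\gg0$, for every $0\ne E\in\mathcal A$. Put $\mathcal A_{\ker Z}=\{E\in\mathcal A: Z(E)=0\}$. For $E\in\mathcal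 A\setminus\mathcal A_{\ker Z}$ the phase $\phi_Z(E)$ is determined by $Z(E)(v)\in\mathbb R_{>0}e^{i\pi\phi_Z(E)(v)}$ for $v\gg 0$ and $\phi_0\prec\phi_Z(E)\preceq\phi_0+1$. A *weak polynomial stability data* $(Z,\mathcal A,S)$ with respect to $(\phi_0,\phi_0+1]$ consists of such $\mathcal A$ and $Z$ and a family $S$ assigning to each nonzero $k\in\mathcal A_{\ker Z}$ a polynomial phase function $\phi_Z(k)$ with $\phi_0\prec\phi_Z(k)\preceq\phi_0+1$. A nonzero $E\in\mathcal A$ is *$Z$-semistable* (resp. *$Z$-stable*) if $\phi_Z(M)\preceq\phi_Z(N)$ (resp. $\phi_Z(M)\prec\phi_Z(N)$) for every short exact sequence $0\to M\to E\to N\to0$ in $\mathcal A$ with $M,N\ne0$. An object $X$ of $\mathcal D$ is $Z$-(semi)stable if $X[j]$ is a $Z$-(semi)stable object of $\mathcal A$ for some $j\in\mathbb Z$. An element of the universal cover $\widetilde{\mathrm{GL}}^+(2,\mathbb R)$ is a pair $(T_0,f)$ where $T_0\in\mathrm{GL}^+(2,\mathbb R)$ and $f:\mathbb R\to\mathbb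 R$ is an increasing bijection with $f(x+1)=f(x)+1$ inducing on $\mathbb R/2\mathbb Z\cong(\mathbb R^2\setminus0)/\mathbb R_{>0}$ the same map as $T_0$. **Configuration III-w.** * (a) $\Phi:\mathcal D\to\mathcal U$ and $\Psi:\mathcal U\to\mathcal D$ are exact equivalences of triangulated categories with $\Psi\Phi\cong\mathrm{id}_{\mathcal D}[-1]$ and $\Phi\Psi\cong\mathrm{id}_{\mathcal U}[-1]$. * (b) $\mathcal A,\mathcal B$ are hearts of bounded t-structures on $\mathcal D,\mathcal U$, and $\Phi\mathcal A\subset D^{[0,1]}_{\mathcal B}$. * (c) $Z_{\mathcal A}$ and $Z_{\mathcal B}$ are weak polynomial stability functions on $\mathcal A$ and $\mathcal B$ with respect to $(a,a+1]$ and $(b,b+1]$, for polynomial phase functions $a,b$; $T\in\mathrm{GL}(2,\mathbb R(\!(\tfrac1v)\!)^c)$ satisfies $\det T(v)>0$ for $v\gg0$ and $Z_{\mathcal B}(\Phi E)=T\cdot Z_{\mathcal A}(E)$ for all $E\in\mathcal D$, where elements of $\mathbb C(\!(\tfrac1v)\!)^c$ are regarded as column vectors (real part, imaginary part); and for some continuous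 lift $v\mapsto(T(v),g_v)$ of the path $v\mapsto T(v)$ ($v\ge v_1$, some $v_1>0$) to $\widetilde{\mathrm{GL}}^+(2,\mathbb R)$ the induced bijection $\Gamma_T:\phi\mapsto(v\mapsto g_v(\phi(v)))$ satisfies $a\prec\Gamma_T^{-1}(b)\prec a+1$. **Proposition.** Assume Configuration III-w, and let $(Z_{\mathcal A},\mathcal A,S_{\mathcal A})$ and $(Z_{\mathcal B},\mathcal B,S_{\mathcal B})$ be weak polynomial stability data with respect to $(a,a+1]$ and $(b,b+1]$, with phase functions $\phi_{\mathcal A},\phi_{\mathcal B}$. Let $E\in\mathcal A\setminus\mathcal A_{\ker Z_{\mathcal A}}$ be $\Phi_{\mathcal B}$-WIT$_i$, i.e. $\Phi E[i]\in\mathcal B$, for $i=0$ or $i=1$. Suppose that for every short exact sequence $0\to M\to\Phi E[i]\to N\to0$ in $\mathcal B$ with $M,N\neq0$ such that $M$ or $N$ lies in $\mathcal B_{\ker Z_{\mathcal B}}$, we have $\phi_{\mathcal B}(M)\preceq\phi_{\mathcal B}(N)$ (resp. $\phi_{\mathcal B}(M)\prec\phi_{\mathcal B}(N)$). If $E$ is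 $Z_{\mathcal A}$-semistable (resp. $Z_{\mathcal A}$-stable), then $\Phi E$ is $Z_{\mathcal B}$-semistable (resp. $Z_{\mathcal B}$-stable). -/

import Mathlib

open CategoryTheory CategoryTheory.Limits CategoryTheory.Triangulated CategoryTheory.Pretriangulated
open Filter

noncomputable section

/-! ### Convergent Laurent series in `1/v` -/

/-- A formal Laurent series `∑ cₙ wⁿ` is convergent if it converges absolutely at some radius
`r > 0`; equivalently, it converges on some punctured disk of positive radius around the origin. -/
def LaurentConvergent {K : Type*} [RCLike K] (f : LaurentSeries K) : Prop :=
  ∃ r : ℝ, 0 < r ∧ Summable fun n : ℤ => ‖f.coeff n‖ * r ^ n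

/-- Absolute convergence at `r` implies absolute convergence at every smaller radius. -/
theorem laurent_summable_mono {K : Type*} [RCLike K] (f : LaurentSeries K) {r s : ℝ} (hs : 0 < s)
    (hsr : s ≤ r) (hr : Summable fun n : ℤ => ‖f.coeff n‖ * r ^ n) :
    Summable fun n : ℤ => ‖f.coeff n‖ * s ^ n := by
  have hr0 : 0 < r := lt_of_lt_of_le hs hsr
  refine Summable.of_nonneg_of_le (fun n => by positivity) (fun n => ?_)
    (hr.mul_left ((s / r) ^ f.order))
  by_cases hn : n < f.order
  · simp [HahnSeries.coeff_eq_zero_of_lt_order hn]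
  · have h1 : (s / r) ^ n ≤ (s / r) ^ f.order :=
      zpow_le_zpow_right_of_le_one₀ (by positivity) ((div_le_one hr0).2 hsr) (not_lt.1 hn)
    have h2 : s ^ n = (s / r) ^ n * r ^ n := by
      rw [← mul_zpow, div_mul_cancel₀ _ hr0.ne']
    rw [h2]
    have h3 : 0 ≤ ‖f.coeff n‖ * r ^ n := by positivity
    nlinarith [mul_le_mul_of_nonneg_right h1 h3]

theorem LaurentConvergent.add {K : Type*} [RCLike K] {f g : LaurentSeries K}
    (hf : LaurentConvergent f) (hg : LaurentConvergent g) : LaurentConvergent (f + g) := by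
  obtain ⟨r, hr, hfr⟩ := hf
  obtain ⟨s, hs, hgs⟩ := hg
  have hm : 0 < min r s := lt_min hr hs
  refine ⟨min r s, hm, Summable.of_nonneg_of_le (fun n => by positivity) (fun n => ?_)
    ((laurent_summable_mono f hm (min_le_left _ _) hfr).add
      (laurent_summable_mono g hm (min_le_right _ _) hgs))⟩
  rw [← add_mul, HahnSeries.coeff_add]
  exact mul_le_mul_of_nonneg_right (norm_add_le _ _) (by positivity)

theorem LaurentConvergent.mul {K : Type*} [RCLike K] {f g : LaurentSeries K}
    (hf : LaurentConvergent f) (hg : LaurentConvergent g) : LaurentConvergent (f * g) := by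
  obtain ⟨r₁, hr₁, hf₁⟩ := hf
  obtain ⟨r₂, hr₂, hg₂⟩ := hg
  have hr : 0 < min r₁ r₂ := lt_min hr₁ hr₂
  have hF := laurent_summable_mono f hr (min_le_left _ _) hf₁
  have hG := laurent_summable_mono g hr (min_le_right _ _) hg₂
  set r := min r₁ r₂
  let e : ℤ × ℤ ≃ ℤ × ℤ :=
    { toFun := fun p => (p.2, p.1 - p.2)
      invFun := fun p => (p.1 + p.2, p.1)
      left_inv := fun p => by simp
      right_inv := fun p => by simp }
  have hP := (hF.mul_of_nonneg hG (fun n => by positivity) (fun n => by positivity))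
  have hQ := (Equiv.summable_iff e).2 hP
  rw [summable_prod_of_nonneg (fun p => by simp only [Function.comp, Pi.zero_apply]; positivity)]
    at hQ
  refine ⟨r, hr, Summable.of_nonneg_of_le (fun n => by positivity) (fun n => ?_) hQ.2⟩
  rw [HahnSeries.coeff_mul]
  refine (mul_le_mul_of_nonneg_right (norm_sum_le _ _) (by positivity)).trans ?_
  rw [Finset.sum_mul]
  have key := (hQ.1 n).sum_le_tsum
    ((Finset.antidiagonal f.isPWO_support g.isPWO_support n).image Prod.fst)
    (fun i _ => by simp only [Function.comp]; positivity)
  refine le_trans (le_of_eq ?_) key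
  rw [Finset.sum_image]
  · refine Finset.sum_congr rfl fun p hp => ?_
    have hn : p.1 + p.2 = n := (Finset.mem_antidiagonal.1 hp).2.2
    have h2 : n - p.1 = p.2 := by omega
    simp only [Function.comp, e, Equiv.coe_fn_mk, h2, norm_mul]
    rw [← hn, zpow_add₀ hr.ne']
    ring
  · intro p hp q hq hpq
    have h1 := (Finset.mem_antidiagonal.1 hp).2.2
    have h2 := (Finset.mem_antidiagonal.1 hq).2.2
    ext
    · exact hpq
    · omega

theorem laurentConvergent_single {K : Type*} [RCLike K] (c : K) :
    LaurentConvergent (HahnSeries.single (0 : ℤ) c) := by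
  refine ⟨1, one_pos, summable_of_ne_finset_zero (s := {0}) fun n hn => ?_⟩
  rw [HahnSeries.coeff_single_of_ne (by simpa using hn)]
  simp

/-- The convergent Laurent series form a subring (in fact a subfield) of the Laurent series. -/
def convLaurentSubring (K : Type*) [RCLike K] : Subring (LaurentSeries K) where
  carrier := {f | LaurentConvergent f}
  zero_mem' := ⟨1, one_pos, by simp⟩
  one_mem' := laurentConvergent_single 1
  add_mem' := LaurentConvergent.add
  mul_mem' := LaurentConvergent.mul
  neg_mem' := by
    rintro f ⟨r, hr, h⟩
    exact ⟨r, hr, by simpa using h⟩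

/-- `K((1/v))ᶜ`: the field of convergent Laurent series in `w = 1/v` over `K = ℝ` or `ℂ`. -/
abbrev ConvLaurent (K : Type*) [RCLike K] : Type _ := convLaurentSubring K

/-- The value at (large) `v > 0` of a convergent Laurent series in `1/v`. -/
def ConvLaurent.eval {K : Type*} [RCLike K] (f : ConvLaurent K) (v : ℝ) : K :=
  ∑' n : ℤ, f.1.coeff n * ((v : K)⁻¹) ^ n

/-- The coefficientwise real part. -/
def ConvLaurent.re (f : ConvLaurent ℂ) : ConvLaurent ℝ :=
  ⟨f.1.map Complex.reAddGroupHom, by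
    obtain ⟨r, hr, h⟩ := f.2
    refine ⟨r, hr, Summable.of_nonneg_of_le (fun n => by positivity) (fun n => ?_) h⟩
    exact mul_le_mul_of_nonneg_right (Complex.abs_re_le_norm _) (by positivity)⟩

/-- The coefficientwise imaginary part. -/
def ConvLaurent.im (f : ConvLaurent ℂ) : ConvLaurent ℝ :=
  ⟨f.1.map Complex.imAddGroupHom, by
    obtain ⟨r, hr, h⟩ := f.2
    refine ⟨r, hr, Summable.of_nonneg_of_le (fun n => by positivity) (fun n => ?_) h⟩
    exact mul_le_mul_of_nonneg_right (Complex.abs_im_le_norm _) (by positivity)⟩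

/-- A complex convergent Laurent series as a column vector with real convergent entries. -/
def ConvLaurent.toColumn (f : ConvLaurent ℂ) : Fin 2 → ConvLaurent ℝ := ![f.re, f.im]

/-! ### Polynomial phase functions -/

/-- `φ₁ ≺ φ₂`: strict inequality for all `v ≫ 0`. -/
def PhaseLT (φ₁ φ₂ : ℝ → ℝ) : Prop := ∀ᶠ v in atTop, φ₁ v < φ₂ v

/-- `φ₁ ≼ φ₂`: inequality for all `v ≫ 0`. -/
def PhaseLE (φ₁ φ₂ : ℝ → ℝ) : Prop := ∀ᶠ v in atTop, φ₁ v ≤ φ₂ v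

/-- `φ` is (a representative of) a polynomial phase function: a function, continuous for `v ≫ 0`,
such that for some convergent Laurent series `f ≠ 0` in `1/v` one has
`f(v) ∈ ℝ_{>0} · exp(iπφ(v))` for `v ≫ 0`. -/
def IsPolynomialPhase (φ : ℝ → ℝ) : Prop :=
  (∀ᶠ v in atTop, ContinuousAt φ v) ∧
    ∃ f : ConvLaurent ℂ, f ≠ 0 ∧
      ∀ᶠ v in atTop, ∃ r : ℝ, 0 < r ∧ f.eval v = r * Complex.exp (Complex.I * Real.pi * φ v)

/-- The number `θ ∈ (c, c + 2]` with `z ∈ ℝ_{>0} · exp(iπθ)`, for `z ≠ 0`. -/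
def phaseAbove (c : ℝ) (z : ℂ) : ℝ := toIocMod (two_pos : (0 : ℝ) < 2) c (z.arg / Real.pi)

/-- If `z = r · exp(iπθ)` with `r > 0` and `θ ∈ (c, c + 1]` then `phaseAbove c z = θ`. -/
theorem phaseAbove_eq (c θ r : ℝ) (hr : 0 < r) (h₁ : c < θ) (h₂ : θ ≤ c + 1) :
    phaseAbove c (r * Complex.exp (Complex.I * Real.pi * θ)) = θ := by
  rw [phaseAbove, toIocMod_eq_iff]
  refine ⟨⟨h₁, by linarith⟩, -toIocDiv Real.two_pi_pos (-Real.pi) (Real.pi * θ), ?_⟩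
  have : Complex.I * Real.pi * θ = ((Real.pi * θ : ℝ) : ℂ) * Complex.I := by push_cast; ring
  rw [this, Complex.arg_real_mul _ hr, Complex.arg_exp_mul_I, toIocMod]
  have hpi := Real.pi_ne_zero
  simp only [zsmul_eq_mul, Int.cast_neg]
  field_simp
  ring

/-! ### The group `GL̃⁺(2,ℝ)` and the maps induced by families of matrices -/

/-- An element of the universal cover of `GL⁺(2,ℝ)`: a matrix `T` of positive determinant together
with an increasing bijection `f : ℝ → ℝ` with `f(φ+1) = f(φ)+1` which induces on
`ℝ/2ℤ ≅ (ℝ² ∖ 0)/ℝ_{>0}` the same map as `T`. -/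
structure GLTilde where
  mat : Matrix (Fin 2) (Fin 2) ℝ
  det_pos : 0 < mat.det
  lift : ℝ ≃o ℝ
  lift_add_one : ∀ x, lift (x + 1) = lift x + 1
  compatible : ∀ x : ℝ, ∃ r : ℝ, 0 < r ∧
    mat.mulVec ![Real.cos (Real.pi * x), Real.sin (Real.pi * x)] =
      r • ![Real.cos (Real.pi * lift x), Real.sin (Real.pi * lift x)]

/-- The topology of the universal cover: a path `v ↦ (T_v, f_v)` is continuous iff the entries
of `T_v` and all the values `f_v(x)` vary continuously with `v`. -/
instance : TopologicalSpace GLTilde :=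
  TopologicalSpace.induced (fun g => (g.mat, (g.lift : ℝ → ℝ))) inferInstance

/-- The real matrix `T_v = T(v)`. -/
def evalMatrix (T : GL (Fin 2) (ConvLaurent ℝ)) (v : ℝ) : Matrix (Fin 2) (Fin 2) ℝ :=
  (T : Matrix (Fin 2) (Fin 2) (ConvLaurent ℝ)).map fun f => f.eval v

/-- `T` lies in `GL^{l,+}(2, ℝ((1/v))ᶜ)`: `T_v` has positive determinant for `v ≫ 0`. -/
def IsGLlPlus (T : GL (Fin 2) (ConvLaurent ℝ)) : Prop :=
  ∀ᶠ v in atTop, 0 < (evalMatrix T v).det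

/-- `g` is a lift to `GL̃⁺(2,ℝ)` of the path `[v₁, ∞) → GL⁺(2,ℝ)`, `v ↦ T_v`, for some `v₁ > 0`. -/
def IsLiftedPath (T : GL (Fin 2) (ConvLaurent ℝ)) (g : ℝ → GLTilde) : Prop :=
  ∃ v₁ : ℝ, 0 < v₁ ∧ (∀ v, v₁ ≤ v → (g v).mat = evalMatrix T v) ∧ ContinuousOn g (Set.Ici v₁)

/-- The bijection `Γ_T : φ ↦ (v ↦ g_v(φ(v)))` determined by a lifted path `v ↦ (T_v, g_v)`. -/
def inducedPhaseMap (g : ℝ → GLTilde) : (ℝ → ℝ) ≃ (ℝ → ℝ) :=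
  Equiv.piCongrRight fun v => (g v).lift.toEquiv

/-! ### Triangulated categories, hearts and weak polynomial stability -/

section

universe v u v' u'

variable (C : Type u) [Category.{v} C] [HasZeroObject C] [HasShift C ℤ] [Preadditive C]
  [∀ n : ℤ, (shiftFunctor C n).Additive] [Pretriangulated C]

/-- The relations `[Y] = [X] + [Z]` for distinguished triangles `X → Y → Z → X[1]`. -/
def grothendieckRelations : AddSubgroup (FreeAbelianGroup C) :=
  AddSubgroup.closure {x | ∃ T ∈ distTriang C,
    x = FreeAbelianGroup.of T.obj₂ - FreeAbelianGroup.of T.obj₁ - FreeAbelianGroup.of T.obj₃}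

/-- The Grothendieck group `K(C)` of a triangulated category. -/
abbrev TriangulatedK : Type u := FreeAbelianGroup C ⧸ grothendieckRelations C

variable {C}

/-- The class of an object in the Grothendieck group. -/
def classK (X : C) : TriangulatedK C := QuotientAddGroup.mk (FreeAbelianGroup.of X)

/-- The t-structure is bounded. -/
def IsBoundedTStructure (t : TStructure C) : Prop := ∀ X : C, t.bounded X

/-- The heart of a t-structure, as a category. -/
abbrev HeartCat (t : TStructure C) := t.heart.FullSubcategory

/-- The subcategory `D^{[j,k]}` of a t-structure. -/
def InInterval (t : TStructure C) (j k : ℤ) (X : C) : Prop := t.le k X ∧ t.ge j X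

/-- `Z` is a weak polynomial stability function on the heart of `t` with respect to
`(φ₀, φ₀ + 1]`. -/
def IsWeakPolynomialStabilityFunction (t : TStructure C) (Z : TriangulatedK C →+ ConvLaurent ℂ)
    (φ₀ : ℝ → ℝ) : Prop :=
  IsPolynomialPhase φ₀ ∧ ∀ E : HeartCat t, ¬ IsZero E →
    ∀ᶠ v in atTop, ∃ r θ : ℝ, 0 ≤ r ∧ φ₀ v < θ ∧ θ ≤ φ₀ v + 1 ∧
      (Z (classK E.obj)).eval v = r * Complex.exp (Complex.I * Real.pi * θ)

/-- Membership in `A_{ker Z}`. -/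
def InKer (t : TStructure C) (Z : TriangulatedK C →+ ConvLaurent ℂ) (E : HeartCat t) : Prop :=
  Z (classK E.obj) = 0

variable (C) in
/-- A weak polynomial stability data `(Z, A, S)` on `C` with respect to `(φ₀, φ₀ + 1]`, the heart
`A` being that of the bounded t-structure `t`. -/
structure WeakPolynomialStabilityData (φ₀ : ℝ → ℝ) where
  t : TStructure C
  bounded : IsBoundedTStructure t
  Z : TriangulatedK C →+ ConvLaurent ℂ
  isStabilityFunction : IsWeakPolynomialStabilityFunction t Z φ₀
  /-- the chosen phases of the nonzero objects of `A_{ker Z}` -/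
  S : {k : HeartCat t // ¬ IsZero k ∧ InKer t Z k} → ℝ → ℝ
  S_isPolynomialPhase : ∀ k, IsPolynomialPhase (S k)
  S_gt : ∀ k, PhaseLT φ₀ (S k)
  S_le : ∀ k, PhaseLE (S k) fun v => φ₀ v + 1

namespace WeakPolynomialStabilityData

variable {φ₀ : ℝ → ℝ} (σ : WeakPolynomialStabilityData C φ₀)

open Classical in
/-- The phase function of a nonzero object of the heart: the prescribed one if `Z(E) = 0`, and
otherwise the function `φ` with `φ₀ ≺ φ ≼ φ₀ + 1` and `Z(E)(v) ∈ ℝ_{>0} · exp(iπφ(v))` for `v ≫ 0`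
(see `phaseAbove_eq`). -/
def phase (E : HeartCat σ.t) : ℝ → ℝ :=
  if h : ¬ IsZero E ∧ InKer σ.t σ.Z E then σ.S ⟨E, h⟩
  else fun v => phaseAbove (φ₀ v) ((σ.Z (classK E.obj)).eval v)

/-- `Z`-semistability of an object of the heart. -/
def IsSemistable (E : HeartCat σ.t) : Prop :=
  ¬ IsZero E ∧ ∀ (M N : HeartCat σ.t) (f : M ⟶ E) (g : E ⟶ N) (w : f ≫ g = 0),
    (ShortComplex.mk f g w).ShortExact → ¬ IsZero M → ¬ IsZero N →
      PhaseLE (σ.phase M) (σ.phase N)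

/-- `Z`-stability of an object of the heart. -/
def IsStable (E : HeartCat σ.t) : Prop :=
  ¬ IsZero E ∧ ∀ (M N : HeartCat σ.t) (f : M ⟶ E) (g : E ⟶ N) (w : f ≫ g = 0),
    (ShortComplex.mk f g w).ShortExact → ¬ IsZero M → ¬ IsZero N →
      PhaseLT (σ.phase M) (σ.phase N)

/-- `Z`-semistability of an object of the triangulated category. -/
def IsSemistableObj (X : C) : Prop :=
  ∃ (j : ℤ) (h : σ.t.heart (X⟦j⟧)), σ.IsSemistable ⟨X⟦j⟧, h⟩

/-- `Z`-stability of an object of the triangulated category. -/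
def IsStableObj (X : C) : Prop :=
  ∃ (j : ℤ) (h : σ.t.heart (X⟦j⟧)), σ.IsStable ⟨X⟦j⟧, h⟩

end WeakPolynomialStabilityData

variable {D : Type u'} [Category.{v'} D] [HasZeroObject D] [HasShift D ℤ] [Preadditive D]
  [∀ n : ℤ, (shiftFunctor D n).Additive] [Pretriangulated D]

/-- `X` is `Φ_B`-WIT`_i`: `Φ X ∈ B[-i]`, where `B` is the heart of `tB`. -/
def IsWIT (Φ : C ⥤ D) (tB : TStructure D) (i : ℤ) (X : C) : Prop := tB.heart ((Φ.obj X)⟦i⟧)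

/-- Configuration III-w. The functors `Φ`, `Ψ` are exact (triangulated) by the instance arguments;
`g` is the lifted path which gives the choice of `Γ_T`. -/
structure ConfigurationIIIw (Φ : C ⥤ D) (Ψ : D ⥤ C) [Φ.CommShift ℤ] [Φ.IsTriangulated]
    [Ψ.CommShift ℤ] [Ψ.IsTriangulated] (tA : TStructure C) (tB : TStructure D)
    (a b : ℝ → ℝ) (ZA : TriangulatedK C →+ ConvLaurent ℂ) (ZB : TriangulatedK D →+ ConvLaurent ℂ)
    (T : GL (Fin 2) (ConvLaurent ℝ)) (g : ℝ → GLTilde) : Prop where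
  isEquivalence_Φ : Φ.IsEquivalence
  isEquivalence_Ψ : Ψ.IsEquivalence
  Ψ_Φ : Nonempty (Φ ⋙ Ψ ≅ shiftFunctor C (-1 : ℤ))
  Φ_Ψ : Nonempty (Ψ ⋙ Φ ≅ shiftFunctor D (-1 : ℤ))
  bounded_A : IsBoundedTStructure tA
  bounded_B : IsBoundedTStructure tB
  Φ_heart : ∀ E : C, tA.heart E → InInterval tB 0 1 (Φ.obj E)
  stabilityFunction_A : IsWeakPolynomialStabilityFunction tA ZA a
  stabilityFunction_B : IsWeakPolynomialStabilityFunction tB ZB b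
  isGLlPlus : IsGLlPlus T
  isLiftedPath : IsLiftedPath T g
  /-- `Z_B(Φ E) = T · Z_A(E)` -/
  central_charges : ∀ E : C, (ZB (classK (Φ.obj E))).toColumn =
    (T : Matrix (Fin 2) (Fin 2) (ConvLaurent ℝ)).mulVec (ZA (classK E)).toColumn
  /-- `a ≺ Γ_T⁻¹(b) ≺ a + 1` -/
  lt_phase : PhaseLT a ((inducedPhaseMap g).symm b)
  phase_lt : PhaseLT ((inducedPhaseMap g).symm b) fun v => a v + 1

end

end

/-! Write `z ∧ w` for the determinant of two plane vectors. Two nonzero charges whose phases lie in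
a common window `(c, c + 1]` have phases ordered according to the sign of `z ∧ w`. So off the kernel
of `Z`, (semi)stability is a statement about signs of an alternating form which, unlike the phase,
is additive in each class and is only scaled by `det T > 0` under `Φ`.

Let `0 → M → ΦE[i] → N → 0` be exact in the second heart. Applying `Ψ` gives a triangle `ΨM → E[i-1]
→ ΨN`, with `ΨM` and `ΨN` in degrees `[0, 1]`. Truncation and the octahedral axiom extract an exact
sequence `0 → P → E → Q → 0` in the first heart, and bilinearity gives `ΨM ∧ ΨN = P ∧ Q + U ∧ V`.
For `i = 0`, `U = H⁰(ΨN)` and `V = E`; for `i = 1`, `U = E` and `V = H¹(ΨM)`. The first term is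
nonnegative by semistability of `E`. In the second, `U` is WIT₁ and `V` is WIT₀. Objects of nonzero
charge have phase at most `Γ_T⁻¹(b)` if WIT₁ and greater than it if WIT₀, so this term is positive
unless `U` or `V` has zero charge, when it vanishes.

For stability, if `M` and `N` have nonzero charge, then either `U` and `V` both do, or `P` and `Q`
both do, so one of the two terms is strictly positive. Sequences with an end in the kernel of `Z_B`
are covered by hypothesis.

The carrying lemmas are `phaseLE_iff`, `phaseLT_iff`, `eventually_chargeDet_pos`,
`eventually_chargeDet_quasiInverse` and `exists_shortExact_of_shortExact`. -/

noncomputable section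

/-! ### Distinguished triangles, the Grothendieck group and the abelian heart -/

section Heart

variable {C : Type*} [Category* C] [HasZeroObject C] [HasShift C ℤ] [Preadditive C]
  [∀ n : ℤ, (shiftFunctor C n).Additive] [Pretriangulated C] (t : TStructure C)

theorem distinguished_of_iso₁ {X X' Y Z : C} (e : X' ≅ X) {f : X ⟶ Y} {g : Y ⟶ Z}
    {h : Z ⟶ X⟦(1 : ℤ)⟧} (H : Triangle.mk f g h ∈ distTriang C) :
    Triangle.mk (e.hom ≫ f) g (h ≫ e.inv⟦(1 : ℤ)⟧') ∈ distTriang C := by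
  refine isomorphic_distinguished _ H _
    (Triangle.isoMk _ _ e (Iso.refl _) (Iso.refl _) ?_ ?_ ?_)
  · exact Category.comp_id _
  · exact (Category.comp_id _).trans (Category.id_comp _).symm
  · change (h ≫ e.inv⟦(1 : ℤ)⟧') ≫ e.hom⟦(1 : ℤ)⟧' = 𝟙 _ ≫ h
    rw [Category.assoc, ← (shiftFunctor C (1 : ℤ)).map_comp, e.inv_hom_id,
      (shiftFunctor C (1 : ℤ)).map_id, Category.comp_id,
      Category.id_comp]

theorem distinguished_of_iso₂ {X Y Y' Z : C} (e : Y ≅ Y') {f : X ⟶ Y} {g : Y ⟶ Z}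
    {h : Z ⟶ X⟦(1 : ℤ)⟧} (H : Triangle.mk f g h ∈ distTriang C) :
    Triangle.mk (f ≫ e.hom) (e.inv ≫ g) h ∈ distTriang C := by
  refine isomorphic_distinguished _ H _
    (Triangle.isoMk _ _ (Iso.refl _) e.symm (Iso.refl _) ?_ ?_ ?_)
  · change (f ≫ e.hom) ≫ e.inv = 𝟙 _ ≫ f
    simp
  · exact Category.comp_id _
  · change h ≫ (𝟙 X)⟦(1 : ℤ)⟧' = 𝟙 _ ≫ h
    simp

theorem distinguished_of_iso₃ {X Y Z Z' : C} (e : Z ≅ Z') {f : X ⟶ Y} {g : Y ⟶ Z}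
    {h : Z ⟶ X⟦(1 : ℤ)⟧} (H : Triangle.mk f g h ∈ distTriang C) :
    Triangle.mk f (g ≫ e.hom) (e.inv ≫ h) ∈ distTriang C := by
  refine isomorphic_distinguished _ H _
    (Triangle.isoMk _ _ (Iso.refl _) (Iso.refl _) e.symm ?_ ?_ ?_)
  · exact (Category.comp_id _).trans (Category.id_comp _).symm
  · change (g ≫ e.hom) ≫ e.inv = 𝟙 _ ≫ g
    simp
  · change (e.inv ≫ h) ≫ (𝟙 X)⟦(1 : ℤ)⟧' = e.inv ≫ h
    simp

/-- There is a distinguished triangle `X → Y → Z → X[1]`. -/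
def HasDistTriang (X Y Z : C) : Prop :=
  ∃ (f : X ⟶ Y) (g : Y ⟶ Z) (h : Z ⟶ X⟦(1 : ℤ)⟧), Triangle.mk f g h ∈ distTriang C

namespace HasDistTriang

variable {X Y Z : C}

theorem of_mem {T : Triangle C} (hT : T ∈ distTriang C) : HasDistTriang T.obj₁ T.obj₂ T.obj₃ :=
  ⟨T.mor₁, T.mor₂, T.mor₃, hT⟩

theorem of_iso {X' Y' Z' : C} (H : HasDistTriang X Y Z) (e₁ : X ≅ X') (e₂ : Y ≅ Y')
    (e₃ : Z ≅ Z') : HasDistTriang X' Y' Z' := by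
  obtain ⟨f, g, h, hT⟩ := H
  exact ⟨_, _, _, distinguished_of_iso₃ e₃ (distinguished_of_iso₂ e₂
    (distinguished_of_iso₁ e₁.symm hT))⟩

theorem rotate (H : HasDistTriang X Y Z) : HasDistTriang Y Z (X⟦(1 : ℤ)⟧) := by
  obtain ⟨f, g, h, hT⟩ := H
  exact of_mem (rot_of_distTriang _ hT)

theorem invRotate (H : HasDistTriang X Y Z) : HasDistTriang (Z⟦(-1 : ℤ)⟧) X Y := by
  obtain ⟨f, g, h, hT⟩ := H
  exact of_mem (inv_rot_of_distTriang _ hT)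

theorem shift (H : HasDistTriang X Y Z) (n : ℤ) : HasDistTriang (X⟦n⟧) (Y⟦n⟧) (Z⟦n⟧) := by
  obtain ⟨f, g, h, hT⟩ := H
  exact of_mem (Triangle.shift_distinguished _ hT n)

theorem map {D : Type*} [Category* D] [HasZeroObject D] [HasShift D ℤ] [Preadditive D]
    [∀ n : ℤ, (shiftFunctor D n).Additive] [Pretriangulated D] (H : HasDistTriang X Y Z)
    (F : C ⥤ D) [F.CommShift ℤ] [F.IsTriangulated] :
    HasDistTriang (F.obj X) (F.obj Y) (F.obj Z) := by
  obtain ⟨f, g, h, hT⟩ := H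
  exact of_mem (F.map_distinguished _ hT)

theorem isLE₂ (H : HasDistTriang X Y Z) {n : ℤ} (h₁ : t.IsLE X n) (h₃ : t.IsLE Z n) :
    t.IsLE Y n := by
  obtain ⟨f, g, h, hT⟩ := H
  exact t.isLE₂ _ hT n h₁ h₃

theorem isGE₂ (H : HasDistTriang X Y Z) {n : ℤ} (h₁ : t.IsGE X n) (h₃ : t.IsGE Z n) :
    t.IsGE Y n := by
  obtain ⟨f, g, h, hT⟩ := H
  exact t.isGE₂ _ hT n h₁ h₃

theorem isLE₃ (H : HasDistTriang X Y Z) {n : ℤ} (h₁ : t.IsLE X (n + 1)) (h₂ : t.IsLE Y n) :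
    t.IsLE Z n :=
  H.rotate.isLE₂ t h₂ (t.isLE_shift X (n + 1) 1 n)

theorem isGE₃ (H : HasDistTriang X Y Z) {n : ℤ} (h₁ : t.IsGE X (n + 1)) (h₂ : t.IsGE Y n) :
    t.IsGE Z n :=
  H.rotate.isGE₂ t h₂ (t.isGE_shift X (n + 1) 1 n)

theorem isGE₁ (H : HasDistTriang X Y Z) {n : ℤ} (h₂ : t.IsGE Y n) (h₃ : t.IsGE Z (n - 1)) :
    t.IsGE X n :=
  H.invRotate.isGE₂ t (t.isGE_shift Z (n - 1) (-1) n) h₂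

theorem classK_eq (H : HasDistTriang X Y Z) : classK Y = classK X + classK Z := by
  obtain ⟨f, g, h, hT⟩ := H
  have := (QuotientAddGroup.eq_zero_iff _).2
    (AddSubgroup.subset_closure (k := {x | ∃ T ∈ distTriang C, x = FreeAbelianGroup.of T.obj₂ -
      FreeAbelianGroup.of T.obj₁ - FreeAbelianGroup.of T.obj₃}) ⟨_, hT, rfl⟩)
  rw [QuotientAddGroup.mk_sub, QuotientAddGroup.mk_sub, sub_sub, sub_eq_zero] at this
  exact this

end HasDistTriang

theorem classK_of_isZero {X : C} (hX : IsZero X) : classK X = 0 := by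
  have := (HasDistTriang.of_mem (contractible_distinguished X)).of_iso (Iso.refl X) (Iso.refl X)
    (hX.iso (isZero_zero C)).symm |>.classK_eq
  simpa using this

theorem classK_congr {X Y : C} (e : X ≅ Y) : classK X = classK Y := by
  have := (HasDistTriang.of_mem (contractible_distinguished X)).of_iso (Iso.refl X) e
    (Iso.refl _) |>.classK_eq
  rw [this]
  exact (add_eq_left.2 (classK_of_isZero (isZero_zero C))).symm

theorem classK_shift_one (X : C) : classK (X⟦(1 : ℤ)⟧) = -classK X := by
  have := (HasDistTriang.of_mem (contractible_distinguished X)).rotate.classK_eq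
  exact (neg_eq_of_add_eq_zero_right
    (this.symm.trans (classK_of_isZero (isZero_zero C)))).symm

theorem classK_shift_neg_one (X : C) : classK (X⟦(-1 : ℤ)⟧) = -classK X := by
  have h : classK (X⟦(-1 : ℤ)⟧⟦(1 : ℤ)⟧) = classK X :=
    classK_congr ((shiftEquiv C (1 : ℤ)).counitIso.app X)
  rw [← h, classK_shift_one, neg_neg]

theorem classK_shift_zero (X : C) : classK (X⟦(0 : ℤ)⟧) = classK X :=
  classK_congr ((shiftFunctorZero C ℤ).app X)

theorem mem_heart_of_isLE_of_isGE {X : C} (h₁ : t.IsLE X 0) (h₂ : t.IsGE X 0) : t.heart X :=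
  (t.mem_heart_iff X).2 ⟨h₁, h₂⟩

instance : t.heart.IsTriangulatedClosed₂ :=
  .mk' fun T hT h₁ h₃ => by
    rw [t.mem_heart_iff] at h₁ h₃ ⊢
    exact ⟨t.isLE₂ T hT _ h₁.1 h₃.1, t.isGE₂ T hT _ h₁.2 h₃.2⟩

instance : t.heart.ContainsZero :=
  ⟨_, isZero_zero C, mem_heart_of_isLE_of_isGE t (t.isLE_of_isZero (isZero_zero C) 0)
    (t.isGE_of_isZero (isZero_zero C) 0)⟩

instance : t.heart.IsClosedUnderBinaryProducts where
  limitsOfShape_le := by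
    rintro X ⟨p⟩
    refine t.heart.prop_of_iso ?_ (t.heart.ext_of_isTriangulatedClosed₂ _
      (binaryProductTriangle_distinguished _ _)
      (p.prop_diag_obj (.mk .left)) (p.prop_diag_obj (.mk .right)))
    exact IsLimit.conePointUniqueUpToIso (prodIsProd _ _)
      ((IsLimit.postcomposeHomEquiv (diagramIsoPair p.diag) _).2 p.isLimit)

instance : t.heart.IsClosedUnderFiniteProducts := .mk'

instance (X : HeartCat t) : t.IsLE X.obj 0 := ((t.mem_heart_iff _).1 X.property).1

instance (X : HeartCat t) : t.IsGE X.obj 0 := ((t.mem_heart_iff _).1 X.property).2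

theorem heart_hom_shift_neg_eq_zero ⦃X Y : HeartCat t⦄ ⦃n : ℤ⦄
    (f : t.heart.ι.obj X ⟶ (t.heart.ι.obj Y)⟦n⟧) (hn : n < 0) : f = 0 := by
  have : t.IsLE (t.heart.ι.obj X) 0 := inferInstanceAs (t.IsLE X.obj 0)
  have : t.IsGE (t.heart.ι.obj Y) 0 := inferInstanceAs (t.IsGE Y.obj 0)
  have := t.isGE_shift (t.heart.ι.obj Y) 0 n (-n)
  exact t.zero f 0 (-n)

/-- The cone of a morphism of the heart lies in degrees `[-1, 0]`. Its truncation triangle exhibits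
it as an extension of the cokernel by the kernel shifted by one, which is the remaining input for
the heart to be abelian. -/
theorem heart_admissibleMorphism_eq_top :
    AbelianSubcategory.admissibleMorphism t.heart.ι = ⊤ := by
  ext X₁ X₂ f
  simp only [MorphismProperty.top_apply, iff_true]
  intro X₃ f₂ f₃ hT
  have h₁ : t.IsLE X₁.obj 0 := inferInstance
  have h₁' : t.IsGE X₁.obj 0 := inferInstance
  have h₂ : t.IsLE X₂.obj 0 := inferInstance
  have h₂' : t.IsGE X₂.obj 0 := inferInstance
  have hT' : HasDistTriang X₁.obj X₂.obj X₃ := ⟨_, _, _, hT⟩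
  have h₃ : t.IsLE X₃ 0 := hT'.isLE₃ t (t.isLE_of_le X₁.obj 0 1) h₂
  have h₃' : t.IsGE X₃ (-1) := hT'.isGE₃ t h₁' (t.isGE_of_ge X₂.obj (-1) 0)
  obtain ⟨K, Q, hK, hQ, α, β, γ, h⟩ := t.exists_triangle X₃ (-1) 0 (by lia)
  rw [t.le_iff_isLE] at hK
  rw [t.ge_iff_isGE] at hQ
  have h' : HasDistTriang K X₃ Q := ⟨_, _, _, h⟩
  have hK' : t.IsGE K (-1) := h'.isGE₁ t h₃' (t.isGE_of_ge Q _ 0)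
  have hQ' : t.IsLE Q 0 := h'.isLE₃ t (t.isLE_of_le K (-1) _) h₃
  let e : K⟦(-1 : ℤ)⟧⟦(1 : ℤ)⟧ ≅ K := (shiftEquiv C (1 : ℤ)).counitIso.app K
  refine ⟨⟨K⟦(-1 : ℤ)⟧, mem_heart_of_isLE_of_isGE t (t.isLE_shift K (-1) (-1) 0)
    (t.isGE_shift K (-1) (-1) 0)⟩, ⟨Q, mem_heart_of_isLE_of_isGE t hQ' hQ⟩,
    e.hom ≫ α, β, γ ≫ e.inv⟦(1 : ℤ)⟧', distinguished_of_iso₁ e h⟩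

variable [IsTriangulated C]

/-- The heart of a t-structure is an abelian category. -/
instance heartAbelian : Abelian (HeartCat t) :=
  AbelianSubcategory.abelian t.heart.ι (heart_hom_shift_neg_eq_zero t)
    (heart_admissibleMorphism_eq_top t)

variable {t}

/-- An epimorphism `g` of the heart sits in a distinguished triangle whose first map is a kernel of
`g`. Since `f` is also a kernel, uniqueness of kernels replaces that map by `f`. -/
theorem exists_distTriang_of_shortExact {X Y Z : HeartCat t} {f : X ⟶ Y} {g : Y ⟶ Z}
    {w : f ≫ g = 0} (h : (ShortComplex.mk f g w).ShortExact) :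
    ∃ δ : Z.obj ⟶ X.obj⟦(1 : ℤ)⟧, Triangle.mk f.hom g.hom δ ∈ distTriang C := by
  have := h.epi_g
  dsimp at this
  obtain ⟨K, i, δ, hT⟩ := AbelianSubcategory.exists_distinguished_triangle_of_epi
    (heart_hom_shift_neg_eq_zero t) (heart_admissibleMorphism_eq_top t) g
  have hK := AbelianSubcategory.isLimitKernelForkOfDistTriang (heart_hom_shift_neg_eq_zero t)
    i g δ hT
  let e := h.fIsKernel.conePointUniqueUpToIso hK
  have he : e.hom ≫ i = f :=
    h.fIsKernel.conePointUniqueUpToIso_hom_comp hK WalkingParallelPair.zero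
  let e' : X.obj ≅ K.obj := t.heart.ι.mapIso e
  have he' : e'.hom ≫ i.hom = f.hom := congr_arg InducedCategory.Hom.hom he
  have hT' := distinguished_of_iso₁ e' hT
  exact ⟨_, he' ▸ hT'⟩

theorem shortExact_of_distTriang {X Y Z : HeartCat t} (f : X.obj ⟶ Y.obj) (g : Y.obj ⟶ Z.obj)
    (δ : Z.obj ⟶ X.obj⟦(1 : ℤ)⟧) (hT : Triangle.mk f g δ ∈ distTriang C) :
    ∃ w, (ShortComplex.mk (ObjectProperty.homMk f : X ⟶ Y)
      (ObjectProperty.homMk g : Y ⟶ Z) w).ShortExact := by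
  have hf := AbelianSubcategory.isLimitKernelForkOfDistTriang (heart_hom_shift_neg_eq_zero t)
    (ObjectProperty.homMk f : X ⟶ Y) (ObjectProperty.homMk g : Y ⟶ Z) δ hT
  have hg := AbelianSubcategory.isColimitCokernelCoforkOfDistTriang
    (heart_hom_shift_neg_eq_zero t)
    (ObjectProperty.homMk f : X ⟶ Y) (ObjectProperty.homMk g : Y ⟶ Z) δ hT
  have w : (ObjectProperty.homMk f : X ⟶ Y) ≫ (ObjectProperty.homMk g : Y ⟶ Z) = 0 :=
    t.heart.ι.map_injective (comp_distTriang_mor_zero₁₂ _ hT)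
  exact ⟨w, @ShortComplex.ShortExact.mk _ _ _ (ShortComplex.mk _ _ w)
    (ShortComplex.exact_of_f_is_kernel (ShortComplex.mk _ _ w) hf)
    (mono_of_isLimit_fork hf) (epi_of_isColimit_cofork hg)⟩

theorem HasDistTriang.exists_shortExact {X Y Z : HeartCat t}
    (H : HasDistTriang X.obj Y.obj Z.obj) :
    ∃ (f : X ⟶ Y) (g : Y ⟶ Z) (w : f ≫ g = 0), (ShortComplex.mk f g w).ShortExact := by
  obtain ⟨f, g, h, hT⟩ := H
  exact ⟨_, _, shortExact_of_distTriang f g h hT⟩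

omit [IsTriangulated C] in
theorem exists_truncation_triangle {Y : C} (h : t.IsGE Y 0) (h' : t.IsLE Y 1) :
    ∃ Y₀ Y₁ : HeartCat t, HasDistTriang Y₀.obj Y (Y₁.obj⟦(-1 : ℤ)⟧) := by
  obtain ⟨Y₀, Y₁, h₀, h₁, u, v, s, hT⟩ := t.exists_triangle Y 0 1 (by lia)
  rw [t.le_iff_isLE] at h₀
  rw [t.ge_iff_isGE] at h₁
  have H : HasDistTriang Y₀ Y Y₁ := ⟨u, v, s, hT⟩
  have h₀' : t.IsGE Y₀ 0 := H.isGE₁ t h (t.isGE_of_ge Y₁ _ 1)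
  have h₁' : t.IsLE Y₁ 1 := H.isLE₃ t (t.isLE_of_le Y₀ 0 _) h'
  exact ⟨⟨Y₀, mem_heart_of_isLE_of_isGE t h₀ h₀'⟩, ⟨Y₁⟦(1 : ℤ)⟧, mem_heart_of_isLE_of_isGE t
    (t.isLE_shift Y₁ 1 1 0) (t.isGE_shift Y₁ 1 1 0)⟩,
    H.of_iso (Iso.refl _) (Iso.refl _) ((shiftEquiv C (1 : ℤ)).unitIso.app Y₁)⟩

/-- If `X → E[-1] → Y` is distinguished with `E` in the heart and `X, Y` in degrees `[0, 1]`, then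
the composite `E → H¹(Y)` is an epimorphism of the heart, whose kernel `I` is such that `I[-1]` is
an extension of `H⁰(Y)` by `X`. -/
theorem exists_shortExact_of_hasDistTriang_shift (E : HeartCat t) {X Y : C}
    (hX' : t.IsLE X 1) (hY : t.IsGE Y 0) (hY' : t.IsLE Y 1)
    (H : HasDistTriang X (E.obj⟦(-1 : ℤ)⟧) Y) :
    ∃ (I Y₀ Y₁ : HeartCat t) (p : I ⟶ E) (q : E ⟶ Y₁) (w : p ≫ q = 0),
      (ShortComplex.mk p q w).ShortExact ∧ HasDistTriang Y₀.obj Y (Y₁.obj⟦(-1 : ℤ)⟧) ∧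
        HasDistTriang X (I.obj⟦(-1 : ℤ)⟧) Y₀.obj := by
  obtain ⟨f, g, h, hT⟩ := H
  obtain ⟨Y₀, Y₁, hY₀₁⟩ := exists_truncation_triangle hY hY'
  obtain ⟨u, v, s, hY₀₁'⟩ := id hY₀₁
  -- The octahedron on `E[-1] → Y → H¹(Y)[-1]` makes the fibre `J` of the composite an extension of
  -- `H⁰(Y)` by `X`, hence in degrees `≤ 1`. As the fibre of a map between objects of degree one it
  -- also lies in degrees `≥ 1`, so `J[1]` is in the heart.
  obtain ⟨J, a, b, hJ⟩ := distinguished_cocone_triangle₁ (g ≫ v)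
  have o : HasDistTriang X J Y₀.obj := .of_mem (someOctahedron' rfl hT hY₀₁' hJ).mem
  have hJ' : HasDistTriang J (E.obj⟦(-1 : ℤ)⟧) (Y₁.obj⟦(-1 : ℤ)⟧) := ⟨_, _, _, hJ⟩
  have hY₁ : t.IsGE (Y₁.obj⟦(-1 : ℤ)⟧) 1 := t.isGE_shift Y₁.obj 0 (-1) 1
  have hJ₁ : t.IsGE J 1 := hJ'.isGE₁ t (t.isGE_shift E.obj 0 (-1) 1) (t.isGE_of_ge _ _ 1)
  have hJ₂ : t.IsLE J 1 := o.isLE₂ t hX' (t.isLE_of_le Y₀.obj 0 1)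
  let I : HeartCat t := ⟨J⟦(1 : ℤ)⟧, mem_heart_of_isLE_of_isGE t
    (t.isLE_shift J 1 1 0) (t.isGE_shift J 1 1 0)⟩
  have hI : HasDistTriang I.obj E.obj Y₁.obj := (hJ'.shift 1).of_iso (Iso.refl _)
    ((shiftEquiv C (1 : ℤ)).counitIso.app _) ((shiftEquiv C (1 : ℤ)).counitIso.app _)
  obtain ⟨p, q, w, hpq⟩ := hI.exists_shortExact
  exact ⟨I, Y₀, Y₁, p, q, w, hpq, hY₀₁,
    o.of_iso (Iso.refl _) ((shiftEquiv C (1 : ℤ)).unitIso.app J) (Iso.refl _)⟩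

/-- If `X → E → Y` is distinguished with `E` in the heart and `X, Y` in degrees `[0, 1]`, then
the composite `H⁰(X) → E` is a monomorphism of the heart, whose cokernel `J` is an extension of
`Y` by `H¹(X)[-1]`. -/
theorem exists_shortExact_of_hasDistTriang (E : HeartCat t) {X Y : C}
    (hX : t.IsGE X 0) (hX' : t.IsLE X 1) (hY : t.IsGE Y 0) (H : HasDistTriang X E.obj Y) :
    ∃ (X₀ X₁ J : HeartCat t) (p : X₀ ⟶ E) (q : E ⟶ J) (w : p ≫ q = 0),
      (ShortComplex.mk p q w).ShortExact ∧ HasDistTriang X₀.obj X (X₁.obj⟦(-1 : ℤ)⟧) ∧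
        HasDistTriang (X₁.obj⟦(-1 : ℤ)⟧) J.obj Y := by
  obtain ⟨f, g, h, hT⟩ := H
  obtain ⟨X₀, X₁, hX₀₁⟩ := exists_truncation_triangle hX hX'
  obtain ⟨u, v, s, hX₀₁'⟩ := id hX₀₁
  -- Dually, the cone `J` of `H⁰(X) → X → E` is in degrees `≤ 0` as a cone of objects of the heart,
  -- and in degrees `≥ 0` as an extension of `Y` by `H¹(X)[-1]`.
  obtain ⟨J, a, b, hJ⟩ := distinguished_cocone_triangle (u ≫ f)
  have o : HasDistTriang (X₁.obj⟦(-1 : ℤ)⟧) J Y := .of_mem (someOctahedron rfl hX₀₁' hT hJ).mem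
  have hJ' : HasDistTriang X₀.obj E.obj J := ⟨_, _, _, hJ⟩
  have hE : t.IsLE E.obj 0 := inferInstance
  have hJ₁ : t.IsLE J 0 := hJ'.isLE₃ t (t.isLE_of_le X₀.obj 0 _) hE
  have hX₁ : t.IsGE (X₁.obj⟦(-1 : ℤ)⟧) 1 := t.isGE_shift X₁.obj 0 (-1) 1
  have hJ₂ : t.IsGE J 0 := o.isGE₂ t (t.isGE_of_ge _ 0 1) hY
  let J' : HeartCat t := ⟨J, mem_heart_of_isLE_of_isGE t hJ₁ hJ₂⟩
  obtain ⟨p, q, w, hpq⟩ := HasDistTriang.exists_shortExact (Z := J') hJ'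
  exact ⟨X₀, X₁, J', p, q, w, hpq, hX₀₁, o⟩

end Heart

/-! ### Cohomological amplitude of `Φ` and `Ψ` -/

section Functor

variable {C : Type*} [Category* C] [HasZeroObject C] [HasShift C ℤ] [Preadditive C]
  [∀ n : ℤ, (shiftFunctor C n).Additive] [Pretriangulated C]
  {D : Type*} [Category* D] [HasZeroObject D] [HasShift D ℤ] [Preadditive D]
  [∀ n : ℤ, (shiftFunctor D n).Additive] [Pretriangulated D]
  {Φ : C ⥤ D} [Φ.CommShift ℤ] {tA : TStructure C} {tB : TStructure D}

theorem isLE_obj_isGE_obj_of_heart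
    (hΦ : ∀ E : C, tA.heart E → InInterval tB 0 1 (Φ.obj E)) {X : C} {n : ℤ}
    (h₁ : tA.IsLE X n) (h₂ : tA.IsGE X n) :
    tB.IsLE (Φ.obj X) (n + 1) ∧ tB.IsGE (Φ.obj X) n := by
  obtain ⟨h₃, h₄⟩ := hΦ (X⟦n⟧) (mem_heart_of_isLE_of_isGE tA (tA.isLE_shift X n n 0)
    (tA.isGE_shift X n n 0))
  rw [tB.le_iff_isLE] at h₃
  rw [tB.ge_iff_isGE] at h₄
  have e : Φ.obj (X⟦n⟧) ≅ (Φ.obj X)⟦n⟧ := (Φ.commShiftIso n).app X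
  have h₅ := tB.isLE_of_iso e 1
  have h₆ := tB.isGE_of_iso e 0
  exact ⟨tB.isLE_of_shift _ (n + 1) n 1, tB.isGE_of_shift _ n n 0⟩

variable [Φ.IsTriangulated]

/-- Induction on the width `k` of the range of degrees: truncation splits off the top cohomology,
which is a shift of an object of the heart. -/
theorem isLE_obj_isGE_obj_of_isLE_of_isGE
    (hΦ : ∀ E : C, tA.heart E → InInterval tB 0 1 (Φ.obj E)) (k : ℕ) {X : C} {n : ℤ}
    (h₁ : tA.IsLE X (n + k)) (h₂ : tA.IsGE X n) :
    tB.IsLE (Φ.obj X) (n + k + 1) ∧ tB.IsGE (Φ.obj X) n := by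
  induction k generalizing X with
  | zero =>
    simp only [Nat.cast_zero, add_zero] at h₁ ⊢
    exact isLE_obj_isGE_obj_of_heart hΦ h₁ h₂
  | succ k ih =>
    push_cast at h₁ ⊢
    obtain ⟨Y, Z, hY, hZ, u, v, s, hT⟩ := tA.exists_triangle X (n + k) (n + (k + 1)) (by lia)
    rw [tA.le_iff_isLE] at hY
    rw [tA.ge_iff_isGE] at hZ
    have H : HasDistTriang Y X Z := ⟨u, v, s, hT⟩
    have hY' : tA.IsGE Y n := H.isGE₁ tA h₂ (tA.isGE_of_ge Z _ (n + (k + 1)))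
    have hZ' : tA.IsLE Z (n + (k + 1)) := H.isLE₃ tA (tA.isLE_of_le Y (n + k) _) h₁
    obtain ⟨h₃, h₄⟩ := ih hY hY'
    obtain ⟨h₅, h₆⟩ := isLE_obj_isGE_obj_of_heart hΦ hZ' hZ
    exact ⟨(H.map Φ).isLE₂ tB (tB.isLE_of_le _ (n + k + 1) _) h₅,
      (H.map Φ).isGE₂ tB h₄ (tB.isGE_of_ge _ _ (n + (k + 1)))⟩

theorem isLE_obj_of_isLE (hΦ : ∀ E : C, tA.heart E → InInterval tB 0 1 (Φ.obj E))
    (hA : IsBoundedTStructure tA) {X : C} {n : ℤ} (h : tA.IsLE X n) :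
    tB.IsLE (Φ.obj X) (n + 1) := by
  obtain ⟨⟨m, hm⟩, -⟩ := hA X
  -- Boundedness supplies some lower bound `m`; taking the minimum with `n` makes the width a
  -- natural number.
  have h₁ : tA.IsGE X (min m n) := tA.isGE_of_ge X (min m n) m
  have h₂ : tA.IsLE X (min m n + (n - min m n).toNat) := tA.isLE_of_le X n _
  have h₃ := (isLE_obj_isGE_obj_of_isLE_of_isGE hΦ _ h₂ h₁).1
  exact tB.isLE_of_le _ (min m n + (n - min m n).toNat + 1) (n + 1) (by lia)

theorem isGE_obj_of_isGE (hΦ : ∀ E : C, tA.heart E → InInterval tB 0 1 (Φ.obj E))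
    (hA : IsBoundedTStructure tA) {X : C} {n : ℤ} (h : tA.IsGE X n) :
    tB.IsGE (Φ.obj X) n := by
  obtain ⟨-, ⟨m, hm⟩⟩ := hA X
  have h₂ : tA.IsLE X (n + (max m n - n).toNat) := tA.isLE_of_le X m _
  exact (isLE_obj_isGE_obj_of_isLE_of_isGE hΦ _ h₂ h).2

variable {Ψ : D ⥤ C}

/-- By orthogonality. A map between `ΨF` and a test object is detected by the faithful functor `Φ`,
which sends `ΨF` to `F[-1]`, concentrated in degree one, preserves lower bounds on degrees and
raises upper bounds by at most one. -/
theorem isGE_isLE_obj_of_quasiInverse [Φ.Faithful]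
    (hΦ : ∀ E : C, tA.heart E → InInterval tB 0 1 (Φ.obj E)) (hA : IsBoundedTStructure tA)
    (e : Ψ ⋙ Φ ≅ shiftFunctor D (-1 : ℤ)) (F : HeartCat tB) :
    tA.IsGE (Ψ.obj F.obj) 0 ∧ tA.IsLE (Ψ.obj F.obj) 1 := by
  have e' : Φ.obj (Ψ.obj F.obj) ≅ F.obj⟦(-1 : ℤ)⟧ := e.app F.obj
  have h₁ : tB.IsGE (F.obj⟦(-1 : ℤ)⟧) 1 := tB.isGE_shift F.obj 0 (-1) 1
  have h₂ : tB.IsLE (F.obj⟦(-1 : ℤ)⟧) 1 := tB.isLE_shift F.obj 0 (-1) 1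
  have h₁' := tB.isGE_of_iso e'.symm 1
  have h₂' := tB.isLE_of_iso e'.symm 1
  constructor
  · rw [tA.isGE_iff_orthogonal (-1) 0 (by lia)]
    intro Y f hY
    have := isLE_obj_of_isLE hΦ hA hY
    apply Φ.map_injective
    rw [Φ.map_zero]
    exact tB.zero _ (-1 + 1) 1
  · rw [tA.isLE_iff_orthogonal 1 2 (by lia)]
    intro Y f hY
    have := isGE_obj_of_isGE hΦ hA hY
    apply Φ.map_injective
    rw [Φ.map_zero]
    exact tB.zero _ 1 2

/-- Applying `Φ` gives a triangle `ΦX₀ → F[-1] → (ΦX₁)[-1]` whose terms lie in degrees `[0, 1]`, `1`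
and `[1, 2]`. The long exact sequence leaves only degree one for the two outer terms. -/
theorem isWIT_of_hasDistTriang
    (hΦ : ∀ E : C, tA.heart E → InInterval tB 0 1 (Φ.obj E))
    (e : Ψ ⋙ Φ ≅ shiftFunctor D (-1 : ℤ)) (F : HeartCat tB) {X₀ X₁ : HeartCat tA}
    (H : HasDistTriang X₀.obj (Ψ.obj F.obj) (X₁.obj⟦(-1 : ℤ)⟧)) :
    IsWIT Φ tB 1 X₀.obj ∧ IsWIT Φ tB 0 X₁.obj := by
  have H' : HasDistTriang (Φ.obj X₀.obj) (F.obj⟦(-1 : ℤ)⟧) ((Φ.obj X₁.obj)⟦(-1 : ℤ)⟧) :=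
    (H.map Φ).of_iso (Iso.refl _) (e.app F.obj) ((Φ.commShiftIso (-1 : ℤ)).app X₁.obj)
  obtain ⟨h₁, h₂⟩ := hΦ _ X₀.property
  obtain ⟨h₃, h₄⟩ := hΦ _ X₁.property
  simp only [tB.le_iff_isLE, tB.ge_iff_isGE] at h₁ h₂ h₃ h₄
  have h₅ : tB.IsGE (F.obj⟦(-1 : ℤ)⟧) 1 := tB.isGE_shift F.obj 0 (-1) 1
  have h₆ : tB.IsLE (F.obj⟦(-1 : ℤ)⟧) 1 := tB.isLE_shift F.obj 0 (-1) 1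
  have h₇ : tB.IsGE ((Φ.obj X₁.obj)⟦(-1 : ℤ)⟧) 1 := tB.isGE_shift _ 0 (-1) 1
  have h₈ : tB.IsGE (Φ.obj X₀.obj) 1 := H'.isGE₁ tB h₅ (tB.isGE_of_ge _ _ 1)
  have h₉ : tB.IsLE ((Φ.obj X₁.obj)⟦(-1 : ℤ)⟧) 1 := H'.isLE₃ tB (tB.isLE_of_le _ 1 _) h₆
  have h₁₀ : tB.IsLE (Φ.obj X₁.obj) 0 := tB.isLE_of_shift _ 0 (-1) 1
  exact ⟨mem_heart_of_isLE_of_isGE tB (tB.isLE_shift _ 1 1 0) (tB.isGE_shift _ 1 1 0),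
    mem_heart_of_isLE_of_isGE tB (tB.isLE_shift _ 0 0 0) (tB.isGE_shift _ 0 0 0)⟩

end Functor

/-! ### Evaluation of convergent Laurent series at large `v` -/

namespace ConvLaurent

section Eval

variable {K : Type*} [RCLike K]

theorem eventually_summable_norm (f : ConvLaurent K) :
    ∀ᶠ v : ℝ in atTop, 0 < v ∧ Summable fun n : ℤ => ‖f.1.coeff n * ((v : K)⁻¹) ^ n‖ := by
  obtain ⟨r, hr, h⟩ := f.2
  filter_upwards [eventually_ge_atTop r⁻¹] with v hv
  have hv0 : 0 < v := (inv_pos.2 hr).trans_le hv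
  refine ⟨hv0, ?_⟩
  simpa [abs_of_pos hv0] using laurent_summable_mono f.1 (inv_pos.2 hv0) (inv_le_of_inv_le₀ hr hv) h

@[simp]
theorem eval_zero (v : ℝ) : (0 : ConvLaurent K).eval v = 0 := by
  simp [eval]

@[simp]
theorem eval_neg (f : ConvLaurent K) (v : ℝ) : (-f).eval v = -f.eval v := by
  simp [eval, tsum_neg]

theorem eventually_eval_add (f g : ConvLaurent K) :
    ∀ᶠ v : ℝ in atTop, (f + g).eval v = f.eval v + g.eval v := by
  filter_upwards [eventually_summable_norm f, eventually_summable_norm g] with v hf hg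
  rw [eval, eval, eval, ← hf.2.of_norm.tsum_add hg.2.of_norm]
  simp [add_mul]

/-- The Cauchy product of two absolutely convergent series indexed by `ℤ`. -/
theorem tsum_mul_tsum_int {F G : ℤ → K} (hF : Summable fun n => ‖F n‖)
    (hG : Summable fun n => ‖G n‖) :
    (∑' n, F n) * ∑' n, G n = ∑' n : ℤ, ∑' k : ℤ, F k * G (n - k) := by
  let e : ℤ × ℤ ≃ ℤ × ℤ :=
    { toFun := fun p => (p.2, p.1 - p.2)
      invFun := fun p => (p.1 + p.2, p.1)
      left_inv := fun p => by simp
      right_inv := fun p => by simp }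
  have hP : Summable fun p : ℤ × ℤ => F p.1 * G p.2 := summable_mul_of_summable_norm hF hG
  have hQ : Summable fun p : ℤ × ℤ => F p.2 * G (p.1 - p.2) := (Equiv.summable_iff e).2 hP
  rw [tsum_mul_tsum_of_summable_norm hF hG, ← hQ.tsum_prod]
  exact (Equiv.tsum_eq e (fun p : ℤ × ℤ => F p.1 * G p.2)).symm

theorem coeff_mul_mul_zpow (f g : LaurentSeries K) {x : K} (hx : x ≠ 0) (n : ℤ) :
    (f * g).coeff n * x ^ n =
      ∑' k : ℤ, f.coeff k * x ^ k * (g.coeff (n - k) * x ^ (n - k)) := by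
  rw [HahnSeries.coeff_mul, Finset.sum_mul, tsum_eq_sum (s :=
    (Finset.antidiagonal f.isPWO_support g.isPWO_support n).image Prod.fst)]
  · rw [Finset.sum_image]
    · refine Finset.sum_congr rfl fun p hp => ?_
      have hn : p.1 + p.2 = n := (Finset.mem_antidiagonal.1 hp).2.2
      have h2 : n - p.1 = p.2 := by omega
      rw [h2, ← hn, zpow_add₀ hx]
      ring
    · intro p hp q hq hpq
      have h1 := (Finset.mem_antidiagonal.1 hp).2.2
      have h2 := (Finset.mem_antidiagonal.1 hq).2.2
      ext
      · exact hpq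
      · omega
  · intro k hk
    by_contra hne
    refine hk (Finset.mem_image.2 ⟨(k, n - k), Finset.mem_antidiagonal.2 ⟨?_, ?_, ?_⟩, rfl⟩)
    · exact fun h => hne (by simp [h])
    · exact fun h => hne (by simp [h])
    · simp

theorem eventually_eval_mul (f g : ConvLaurent K) :
    ∀ᶠ v : ℝ in atTop, (f * g).eval v = f.eval v * g.eval v := by
  filter_upwards [eventually_summable_norm f, eventually_summable_norm g] with v hf hg
  have hv : ((v : K)⁻¹) ≠ 0 := inv_ne_zero (RCLike.ofReal_ne_zero.2 hf.1.ne')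
  rw [eval, eval, eval, tsum_mul_tsum_int hf.2 hg.2]
  exact tsum_congr fun n => coeff_mul_mul_zpow f.1 g.1 hv n

/-- The leading term dominates. With `q = v⁻¹ / r` it has norm `q ^ m * (‖c_m‖ * r ^ m)`, while the
others sum to at most `q ^ (m + 1) * S`. Cancellation is impossible once `q * S < ‖c_m‖ * r ^ m`. -/
theorem eventually_eval_ne_zero {f : ConvLaurent K} (hf : f ≠ 0) :
    ∀ᶠ v : ℝ in atTop, f.eval v ≠ 0 := by
  obtain ⟨r, hr, h⟩ := f.2
  set m := f.1.order
  have hf' : f.1 ≠ 0 := fun h => hf (Subtype.ext h)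
  have hm : 0 < ‖f.1.coeff m‖ * r ^ m := by
    have := HahnSeries.coeff_order_eq_zero.not.2 hf'
    positivity
  set S := ∑' n : ℤ, ‖f.1.coeff n‖ * r ^ n
  have hlim : Tendsto (fun v : ℝ => v⁻¹ / r * S) atTop (nhds 0) := by
    simpa using (tendsto_inv_atTop_zero.div_const r).mul_const S
  filter_upwards [eventually_summable_norm f, hlim.eventually_lt_const hm,
    eventually_ge_atTop r⁻¹] with v hv hS hvr
  have hv0 := hv.1
  have hs : v⁻¹ / r ≤ 1 := (div_le_one hr).2 (inv_le_of_inv_le₀ hr hvr)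
  set q := v⁻¹ / r
  have hq : 0 < q := by positivity
  have hnorm : ∀ n : ℤ, ‖f.1.coeff n * ((v : K)⁻¹) ^ n‖ = q ^ n * (‖f.1.coeff n‖ * r ^ n) := by
    intro n
    have : (v⁻¹ : ℝ) = q * r := by simp only [q]; field_simp
    rw [norm_mul, norm_zpow, norm_inv, RCLike.norm_ofReal, abs_of_pos hv0, this, mul_zpow]
    ring
  intro h0
  rw [eval, hv.2.of_norm.tsum_eq_add_tsum_ite m, add_eq_zero_iff_eq_neg] at h0
  have h1 := congr_arg norm h0
  rw [norm_neg, hnorm] at h1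
  have hb : ∀ n : ℤ, ‖ite (n = m) 0 (f.1.coeff n * ((v : K)⁻¹) ^ n)‖ ≤
      q ^ (m + 1) * (‖f.1.coeff n‖ * r ^ n) := by
    intro n
    split_ifs with hn
    · rw [norm_zero]; positivity
    · rcases lt_or_gt_of_ne hn with hn | hn
      · rw [HahnSeries.coeff_eq_zero_of_lt_order hn]; simp
      · rw [hnorm]
        exact mul_le_mul_of_nonneg_right (zpow_le_zpow_right_of_le_one₀ hq hs (by omega))
          (by positivity)
  have h2 := tsum_of_norm_bounded (h.hasSum.mul_left (q ^ (m + 1))) hb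
  rw [← h1, zpow_add_one₀ hq.ne', mul_assoc] at h2
  exact absurd (le_of_mul_le_mul_left h2 (by positivity)) (not_le.2 hS)

end Eval

theorem eventually_eval_re (f : ConvLaurent ℂ) :
    ∀ᶠ v : ℝ in atTop, f.re.eval v = (f.eval v).re := by
  filter_upwards [eventually_summable_norm f] with v hf
  rw [eval, eval, Complex.re_tsum hf.2.of_norm]
  refine tsum_congr fun n => ?_
  have : ((v : ℂ)⁻¹) ^ n = ((v⁻¹ ^ n : ℝ) : ℂ) := by push_cast; rfl
  change (f.1.coeff n).re * v⁻¹ ^ n = (f.1.coeff n * ((v : ℂ)⁻¹) ^ n).re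
  rw [this, Complex.re_mul_ofReal]

theorem eventually_eval_im (f : ConvLaurent ℂ) :
    ∀ᶠ v : ℝ in atTop, f.im.eval v = (f.eval v).im := by
  filter_upwards [eventually_summable_norm f] with v hf
  rw [eval, eval, Complex.im_tsum hf.2.of_norm]
  refine tsum_congr fun n => ?_
  have : ((v : ℂ)⁻¹) ^ n = ((v⁻¹ ^ n : ℝ) : ℂ) := by push_cast; rfl
  change (f.1.coeff n).im * v⁻¹ ^ n = (f.1.coeff n * ((v : ℂ)⁻¹) ^ n).im
  rw [this, Complex.im_mul_ofReal]

theorem toColumn_injective : Function.Injective toColumn := by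
  intro f g h
  have h₀ : f.re = g.re := congr_fun h 0
  have h₁ : f.im = g.im := congr_fun h 1
  ext n
  exact Complex.ext (congr_arg (fun x : ConvLaurent ℝ => x.1.coeff n) h₀)
    (congr_arg (fun x : ConvLaurent ℝ => x.1.coeff n) h₁)

@[simp]
theorem toColumn_zero : toColumn 0 = 0 := by
  ext i n
  fin_cases i
  · exact Complex.zero_re
  · exact Complex.zero_im

end ConvLaurent

/-! ### Plane geometry: orientation, phases and the action of the universal cover -/

/-- A complex number as a column vector. -/
def complexColumn (z : ℂ) : Fin 2 → ℝ := ![z.re, z.im]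

theorem eventually_complexColumn_eval {T : GL (Fin 2) (ConvLaurent ℝ)} {f g : ConvLaurent ℂ}
    (h : g.toColumn = (T : Matrix (Fin 2) (Fin 2) (ConvLaurent ℝ)).mulVec f.toColumn) :
    ∀ᶠ v in atTop, complexColumn (g.eval v) = (evalMatrix T v).mulVec (complexColumn (f.eval v)) := by
  have h₀ : g.re = T.1 0 0 * f.re + T.1 0 1 * f.im := by
    simpa [ConvLaurent.toColumn, Matrix.mulVec, dotProduct, Fin.sum_univ_two] using congr_fun h 0
  have h₁ : g.im = T.1 1 0 * f.re + T.1 1 1 * f.im := by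
    simpa [ConvLaurent.toColumn, Matrix.mulVec, dotProduct, Fin.sum_univ_two] using congr_fun h 1
  filter_upwards [f.eventually_eval_re, f.eventually_eval_im, g.eventually_eval_re,
    g.eventually_eval_im, ConvLaurent.eventually_eval_add (T.1 0 0 * f.re) (T.1 0 1 * f.im),
    ConvLaurent.eventually_eval_add (T.1 1 0 * f.re) (T.1 1 1 * f.im),
    ConvLaurent.eventually_eval_mul (T.1 0 0) f.re, ConvLaurent.eventually_eval_mul (T.1 0 1) f.im,
    ConvLaurent.eventually_eval_mul (T.1 1 0) f.re, ConvLaurent.eventually_eval_mul (T.1 1 1) f.im]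
    with v a₁ a₂ a₃ a₄ a₅ a₆ a₇ a₈ a₉ a₁₀
  ext i
  fin_cases i
  · simp [complexColumn, Matrix.mulVec, dotProduct, Fin.sum_univ_two, evalMatrix, ← a₁, ← a₂,
      ← a₃, h₀, a₅, a₇, a₈]
  · simp [complexColumn, Matrix.mulVec, dotProduct, Fin.sum_univ_two, evalMatrix, ← a₁, ← a₂,
      ← a₄, h₁, a₆, a₉, a₁₀]

/-- The determinant of two vectors of the plane. -/
def planeDet (z w : ℂ) : ℝ := z.re * w.im - z.im * w.re

theorem planeDet_of_mulVec {A : Matrix (Fin 2) (Fin 2) ℝ} {z w z' w' : ℂ}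
    (hz : complexColumn z' = A.mulVec (complexColumn z))
    (hw : complexColumn w' = A.mulVec (complexColumn w)) :
    planeDet z' w' = A.det * planeDet z w := by
  have h₀ := congr_fun hz 0
  have h₁ := congr_fun hz 1
  have h₂ := congr_fun hw 0
  have h₃ := congr_fun hw 1
  simp only [complexColumn, Matrix.mulVec, dotProduct, Fin.sum_univ_two, Matrix.cons_val_zero,
    Matrix.cons_val_one] at h₀ h₁ h₂ h₃
  rw [planeDet, planeDet, h₀, h₁, h₂, h₃, Matrix.det_fin_two]
  ring

theorem re_polar (r θ : ℝ) :
    (r * Complex.exp (Complex.I * Real.pi * θ)).re = r * Real.cos (Real.pi * θ) := by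
  have : Complex.I * Real.pi * θ = ((Real.pi * θ : ℝ) : ℂ) * Complex.I := by push_cast; ring
  rw [this, Complex.re_ofReal_mul, Complex.exp_ofReal_mul_I_re]

theorem im_polar (r θ : ℝ) :
    (r * Complex.exp (Complex.I * Real.pi * θ)).im = r * Real.sin (Real.pi * θ) := by
  have : Complex.I * Real.pi * θ = ((Real.pi * θ : ℝ) : ℂ) * Complex.I := by push_cast; ring
  rw [this, Complex.im_ofReal_mul, Complex.exp_ofReal_mul_I_im]

theorem complexColumn_polar (r θ : ℝ) :
    complexColumn (r * Complex.exp (Complex.I * Real.pi * θ)) =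
      r • ![Real.cos (Real.pi * θ), Real.sin (Real.pi * θ)] := by
  rw [complexColumn, re_polar, im_polar]
  simp

theorem complexColumn_injective : Function.Injective complexColumn := fun _ _ h =>
  Complex.ext (congr_fun h 0) (congr_fun h 1)

theorem planeDet_polar (r θ s η : ℝ) :
    planeDet (r * Complex.exp (Complex.I * Real.pi * θ))
      (s * Complex.exp (Complex.I * Real.pi * η)) = r * s * Real.sin (Real.pi * (η - θ)) := by
  rw [planeDet, re_polar, re_polar, im_polar, im_polar, mul_sub, Real.sin_sub]
  ring

theorem planeDet_polar_pos {r θ s η : ℝ} (hr : 0 < r) (hs : 0 < s) (h₁ : θ < η)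
    (h₂ : η < θ + 1) :
    0 < planeDet (r * Complex.exp (Complex.I * Real.pi * θ))
      (s * Complex.exp (Complex.I * Real.pi * η)) := by
  rw [planeDet_polar]
  have := Real.pi_pos
  exact mul_pos (mul_pos hr hs) (Real.sin_pos_of_pos_of_lt_pi (by nlinarith) (by nlinarith))

theorem planeDet_swap (z w : ℂ) : planeDet w z = -planeDet z w := by
  simp only [planeDet]; ring

/-- In a half-open window of length one the phases differ by less than one, so `sin (π (η - θ))` has
the sign of `η - θ`. -/
theorem planeDet_polar_pos_iff {c r θ s η : ℝ} (hr : 0 < r) (hs : 0 < s) (h₁ : c < θ)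
    (h₂ : θ ≤ c + 1) (h₃ : c < η) (h₄ : η ≤ c + 1) :
    0 < planeDet (r * Complex.exp (Complex.I * Real.pi * θ))
      (s * Complex.exp (Complex.I * Real.pi * η)) ↔ θ < η := by
  refine ⟨fun h => ?_, fun h => planeDet_polar_pos hr hs h (by linarith)⟩
  by_contra! hle
  rcases hle.eq_or_lt with heq | hlt
  · rw [planeDet_polar, heq] at h
    simp at h
  · have := planeDet_polar_pos hs hr hlt (by linarith)
    rw [planeDet_swap] at this
    linarith

theorem planeDet_polar_nonneg_iff {c r θ s η : ℝ} (hr : 0 < r) (hs : 0 < s) (h₁ : c < θ)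
    (h₂ : θ ≤ c + 1) (h₃ : c < η) (h₄ : η ≤ c + 1) :
    0 ≤ planeDet (r * Complex.exp (Complex.I * Real.pi * θ))
      (s * Complex.exp (Complex.I * Real.pi * η)) ↔ θ ≤ η := by
  rw [← not_lt, ← not_lt, ← planeDet_polar_pos_iff hs hr h₃ h₄ h₁ h₂, planeDet_swap, neg_lt_zero]

theorem exists_int_of_polar_eq {r θ s η : ℝ} (hr : 0 < r) (hs : 0 ≤ s)
    (h : (r * Complex.exp (Complex.I * Real.pi * θ) : ℂ) =
      s * Complex.exp (Complex.I * Real.pi * η)) : ∃ k : ℤ, θ = η + 2 * k := by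
  have e : ∀ x : ℝ, Complex.I * Real.pi * x = ((Real.pi * x : ℝ) : ℂ) * Complex.I := by
    intro x; push_cast; ring
  have hrs : r = s := by
    have := congr_arg norm h
    rw [e, e, norm_mul, norm_mul, Complex.norm_exp_ofReal_mul_I, Complex.norm_exp_ofReal_mul_I,
      Complex.norm_real, Complex.norm_real, Real.norm_of_nonneg hr.le, Real.norm_of_nonneg hs]
      at this
    simpa using this
  subst hrs
  have hr' : (r : ℂ) ≠ 0 := by exact_mod_cast hr.ne'
  obtain ⟨k, hk⟩ := Complex.exp_eq_exp_iff_exists_int.1 (mul_left_cancel₀ hr' h)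
  refine ⟨k, ?_⟩
  have hpi := Real.pi_ne_zero
  have hne : Complex.I * Real.pi ≠ 0 := by simp [hpi]
  have : (θ : ℂ) = η + 2 * k := mul_left_cancel₀ hne (by rw [hk]; ring)
  exact_mod_cast this

theorem polar_add_one (s β : ℝ) :
    -(s * Complex.exp (Complex.I * Real.pi * β) : ℂ) =
      s * Complex.exp (Complex.I * Real.pi * ((β - 1 : ℝ) : ℂ)) := by
  have : Complex.I * Real.pi * ((β - 1 : ℝ) : ℂ) =
      Complex.I * Real.pi * β - Real.pi * Complex.I := by push_cast; ring
  rw [this, Complex.exp_sub_pi_mul_I]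
  ring

/-- A member of the universal cover of `GL⁺(2, ℝ)` sends a vector of phase `θ` to a vector of phase
`g.lift θ`. -/
theorem GLTilde.exists_polar_of_mulVec (g : GLTilde) {r θ : ℝ} (hr : 0 < r) {w : ℂ}
    (h : complexColumn w =
      g.mat.mulVec (complexColumn (r * Complex.exp (Complex.I * Real.pi * θ)))) :
    ∃ s : ℝ, 0 < s ∧ w = s * Complex.exp (Complex.I * Real.pi * g.lift θ) := by
  obtain ⟨t, ht, H⟩ := g.compatible θ
  refine ⟨r * t, mul_pos hr ht, complexColumn_injective ?_⟩
  rw [h, complexColumn_polar, complexColumn_polar, Matrix.mulVec_smul, H, smul_smul]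

theorem GLTilde.lt_lift_of_polar (g : GLTilde) {a b r s θ β : ℝ} (hr : 0 < r) (hs : 0 ≤ s)
    (h₁ : a < g.lift.symm b) (h₂ : g.lift.symm b < a + 1) (hθ : a < θ) (hθ' : θ ≤ a + 1)
    (hβ : b < β) (hβ' : β ≤ b + 1)
    (h : (r * Complex.exp (Complex.I * Real.pi * g.lift θ) : ℂ) =
      s * Complex.exp (Complex.I * Real.pi * β)) : g.lift.symm b < θ := by
  obtain ⟨k, hk⟩ := exists_int_of_polar_eq hr hs h
  have h₃ := g.lift.lt_symm_apply.1 h₁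
  have h₄ := g.lift.symm_apply_lt.1 h₂
  rw [g.lift_add_one] at h₄
  have h₅ := g.lift.strictMono hθ
  have h₆ := g.lift.monotone hθ'
  rw [g.lift_add_one] at h₆
  -- Here `b - 1 < g a < b`, so `g θ` lies in `(b - 1, b + 1)`. Since `β` lies in `(b, b + 1]`, the
  -- difference `g θ - β = 2k` lies strictly between `-2` and `2`.
  have h₇ : k < 1 := by
    have : (k : ℝ) < 1 := by linarith
    exact_mod_cast this
  have h₈ : -1 < k := by
    have : (-1 : ℝ) < k := by linarith
    exact_mod_cast this
  obtain rfl : k = 0 := by omega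
  rw [g.lift.symm_apply_lt, hk]
  simpa using hβ

theorem GLTilde.lift_le_of_polar (g : GLTilde) {a b r s θ β : ℝ} (hr : 0 < r) (hs : 0 ≤ s)
    (h₁ : a < g.lift.symm b) (h₂ : g.lift.symm b < a + 1) (hθ : a < θ) (hθ' : θ ≤ a + 1)
    (hβ : b < β) (hβ' : β ≤ b + 1)
    (h : -(r * Complex.exp (Complex.I * Real.pi * g.lift θ) : ℂ) =
      s * Complex.exp (Complex.I * Real.pi * β)) : θ ≤ g.lift.symm b := by
  rw [neg_eq_iff_eq_neg, polar_add_one] at h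
  obtain ⟨k, hk⟩ := exists_int_of_polar_eq hr hs h
  have h₃ := g.lift.lt_symm_apply.1 h₁
  have h₄ := g.lift.symm_apply_lt.1 h₂
  rw [g.lift_add_one] at h₄
  have h₅ := g.lift.strictMono hθ
  have h₆ := g.lift.monotone hθ'
  rw [g.lift_add_one] at h₆
  -- The sign has moved the phase to `β - 1`, in `(b - 1, b]`, while `g θ` is in `(b - 1, b + 1)`;
  -- again the even integer `2k` can only be zero.
  have h₇ : k < 1 := by
    have : (k : ℝ) < 1 := by linarith
    exact_mod_cast this
  have h₈ : -1 < k := by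
    have : (-1 : ℝ) < k := by linarith
    exact_mod_cast this
  obtain rfl : k = 0 := by omega
  rw [g.lift.le_symm_apply, hk]
  simp
  linarith

/-! ### Phases and semistability in terms of determinants of charges -/

section Phase

variable {C : Type*} [Category* C] [HasZeroObject C] [HasShift C ℤ] [Preadditive C]
  [∀ n : ℤ, (shiftFunctor C n).Additive] [Pretriangulated C]

/-- The determinant at `v` of the central charges of two objects. -/
def chargeDet (Z : TriangulatedK C →+ ConvLaurent ℂ) (X Y : C) (v : ℝ) : ℝ :=
  planeDet ((Z (classK X)).eval v) ((Z (classK Y)).eval v)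

theorem chargeDet_eq_zero_left {Z : TriangulatedK C →+ ConvLaurent ℂ} {X : C}
    (h : Z (classK X) = 0) (Y : C) (v : ℝ) : chargeDet Z X Y v = 0 := by
  simp [chargeDet, planeDet, h]

theorem chargeDet_eq_zero_right {Z : TriangulatedK C →+ ConvLaurent ℂ} (X : C) {Y : C}
    (h : Z (classK Y) = 0) (v : ℝ) : chargeDet Z X Y v = 0 := by
  simp [chargeDet, planeDet, h]

theorem inKer_of_isZero {t : TStructure C} (Z : TriangulatedK C →+ ConvLaurent ℂ)
    {E : HeartCat t} (h : IsZero E) : InKer t Z E := by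
  have h' : classK E.obj = 0 := classK_of_isZero (t.heart.ι.map_isZero h)
  rw [InKer, h', map_zero]

theorem IsWeakPolynomialStabilityFunction.eventually_exists_polar {t : TStructure C}
    {Z : TriangulatedK C →+ ConvLaurent ℂ} {φ₀ : ℝ → ℝ}
    (hZ : IsWeakPolynomialStabilityFunction t Z φ₀) {E : HeartCat t} (hE : ¬ InKer t Z E) :
    ∀ᶠ v in atTop, ∃ r θ : ℝ, 0 < r ∧ φ₀ v < θ ∧ θ ≤ φ₀ v + 1 ∧
      (Z (classK E.obj)).eval v = r * Complex.exp (Complex.I * Real.pi * θ) := by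
  filter_upwards [hZ.2 E (fun h => hE (inKer_of_isZero Z h)),
    ConvLaurent.eventually_eval_ne_zero hE] with v ⟨r, θ, hr, h₁, h₂, h⟩ hne
  refine ⟨r, θ, lt_of_le_of_ne hr ?_, h₁, h₂, h⟩
  rintro rfl
  exact hne (by simp [h])

namespace WeakPolynomialStabilityData

variable {φ₀ : ℝ → ℝ} (σ : WeakPolynomialStabilityData C φ₀)

theorem eventually_polar_phase {E : HeartCat σ.t} (hE : ¬ InKer σ.t σ.Z E) :
    ∀ᶠ v in atTop, ∃ r : ℝ, 0 < r ∧ φ₀ v < σ.phase E v ∧ σ.phase E v ≤ φ₀ v + 1 ∧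
      (σ.Z (classK E.obj)).eval v = r * Complex.exp (Complex.I * Real.pi * σ.phase E v) := by
  filter_upwards [σ.isStabilityFunction.eventually_exists_polar hE] with v ⟨r, θ, hr, h₁, h₂, h⟩
  have hθ : σ.phase E v = θ := by
    rw [phase, dif_neg (fun h' => hE h'.2), h, phaseAbove_eq _ _ _ hr h₁ h₂]
  rw [hθ]
  exact ⟨r, hr, h₁, h₂, h⟩

theorem phaseLE_iff {M N : HeartCat σ.t} (hM : ¬ InKer σ.t σ.Z M) (hN : ¬ InKer σ.t σ.Z N) :
    PhaseLE (σ.phase M) (σ.phase N) ↔ ∀ᶠ v in atTop, 0 ≤ chargeDet σ.Z M.obj N.obj v := by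
  refine eventually_congr ?_
  filter_upwards [σ.eventually_polar_phase hM, σ.eventually_polar_phase hN] with v
    ⟨r, hr, h₁, h₂, h⟩ ⟨s, hs, h₁', h₂', h'⟩
  rw [chargeDet, h, h', planeDet_polar_nonneg_iff hr hs h₁ h₂ h₁' h₂']

theorem phaseLT_iff {M N : HeartCat σ.t} (hM : ¬ InKer σ.t σ.Z M) (hN : ¬ InKer σ.t σ.Z N) :
    PhaseLT (σ.phase M) (σ.phase N) ↔ ∀ᶠ v in atTop, 0 < chargeDet σ.Z M.obj N.obj v := by
  refine eventually_congr ?_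
  filter_upwards [σ.eventually_polar_phase hM, σ.eventually_polar_phase hN] with v
    ⟨r, hr, h₁, h₂, h⟩ ⟨s, hs, h₁', h₂', h'⟩
  rw [chargeDet, h, h', planeDet_polar_pos_iff hr hs h₁ h₂ h₁' h₂']

variable {σ}

/-- If an end of the sequence has zero charge the determinant vanishes, so the prescribed phases `S`
play no role. -/
theorem IsSemistable.eventually_chargeDet_nonneg {E M N : HeartCat σ.t} (hE : σ.IsSemistable E)
    {f : M ⟶ E} {g : E ⟶ N} {w : f ≫ g = 0} (h : (ShortComplex.mk f g w).ShortExact) :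
    ∀ᶠ v in atTop, 0 ≤ chargeDet σ.Z M.obj N.obj v := by
  by_cases hM : InKer σ.t σ.Z M
  · exact Eventually.of_forall fun v => (chargeDet_eq_zero_left hM _ v).ge
  by_cases hN : InKer σ.t σ.Z N
  · exact Eventually.of_forall fun v => (chargeDet_eq_zero_right _ hN v).ge
  exact (σ.phaseLE_iff hM hN).1 (hE.2 M N f g w h (fun h => hM (inKer_of_isZero _ h))
    (fun h => hN (inKer_of_isZero _ h)))

theorem IsStable.isSemistable {E : HeartCat σ.t} (hE : σ.IsStable E) : σ.IsSemistable E :=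
  ⟨hE.1, fun M N f g w h hM hN => (hE.2 M N f g w h hM hN).mono fun _ => le_of_lt⟩

theorem IsStable.eventually_chargeDet_pos {E M N : HeartCat σ.t} (hE : σ.IsStable E)
    {f : M ⟶ E} {g : E ⟶ N} {w : f ≫ g = 0} (h : (ShortComplex.mk f g w).ShortExact)
    (hM : ¬ InKer σ.t σ.Z M) (hN : ¬ InKer σ.t σ.Z N) :
    ∀ᶠ v in atTop, 0 < chargeDet σ.Z M.obj N.obj v :=
  (σ.phaseLT_iff hM hN).1 (hE.2 M N f g w h (fun h => hM (inKer_of_isZero _ h))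
    (fun h => hN (inKer_of_isZero _ h)))

end WeakPolynomialStabilityData

end Phase

/-! ### Comparing the two hearts -/

section Configuration

variable {C : Type*} [Category* C] [HasZeroObject C] [HasShift C ℤ] [Preadditive C]
  [∀ n : ℤ, (shiftFunctor C n).Additive] [Pretriangulated C]
  {D : Type*} [Category* D] [HasZeroObject D] [HasShift D ℤ] [Preadditive D]
  [∀ n : ℤ, (shiftFunctor D n).Additive] [Pretriangulated D]
  {Φ : C ⥤ D} {Ψ : D ⥤ C} [Φ.CommShift ℤ] [Φ.IsTriangulated] [Ψ.CommShift ℤ] [Ψ.IsTriangulated]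
  {tA : TStructure C} {tB : TStructure D} {a b : ℝ → ℝ}
  {ZA : TriangulatedK C →+ ConvLaurent ℂ} {ZB : TriangulatedK D →+ ConvLaurent ℂ}
  {T : GL (Fin 2) (ConvLaurent ℝ)} {g : ℝ → GLTilde}

namespace ConfigurationIIIw

variable (config : ConfigurationIIIw Φ Ψ tA tB a b ZA ZB T g)
include config

theorem eventually_exists_polar_obj {X : HeartCat tA} (hX : ¬ InKer tA ZA X) :
    ∀ᶠ v in atTop, ∃ r s θ : ℝ, 0 < r ∧ 0 < s ∧ a v < θ ∧ θ ≤ a v + 1 ∧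
      (ZA (classK X.obj)).eval v = r * Complex.exp (Complex.I * Real.pi * θ) ∧
      (ZB (classK (Φ.obj X.obj))).eval v =
        s * Complex.exp (Complex.I * Real.pi * (g v).lift θ) := by
  obtain ⟨v₁, -, hg, -⟩ := config.isLiftedPath
  filter_upwards [config.stabilityFunction_A.eventually_exists_polar hX, eventually_ge_atTop v₁,
    eventually_complexColumn_eval (config.central_charges X.obj)] with v ⟨r, θ, hr, h₁, h₂, h⟩ hv hT
  rw [h, ← hg v hv] at hT
  obtain ⟨s, hs, hs'⟩ := (g v).exists_polar_of_mulVec hr hT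
  exact ⟨r, s, θ, hr, hs, h₁, h₂, h, hs'⟩

theorem not_isZero_shift_obj {X : C} (hX : ZA (classK X) ≠ 0) (i : ℤ) :
    ¬ IsZero ((Φ.obj X)⟦i⟧) := by
  have := config.isEquivalence_Φ
  intro h
  refine hX ?_
  have h' : IsZero X := by
    rw [IsZero.iff_id_eq_zero] at h ⊢
    exact Φ.map_injective ((shiftFunctor D i).map_injective (by simpa using h))
  rw [classK_of_isZero h', map_zero]

/-- The central charges of a `WIT₁` object and of a `WIT₀` object of the heart are positively
oriented. -/
theorem eventually_chargeDet_pos {X Y : HeartCat tA} (hX : ¬ InKer tA ZA X)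
    (hY : ¬ InKer tA ZA Y) (hX₁ : IsWIT Φ tB 1 X.obj) (hY₀ : IsWIT Φ tB 0 Y.obj) :
    ∀ᶠ v in atTop, 0 < chargeDet ZA X.obj Y.obj v := by
  have hX' : ¬ IsZero (⟨_, hX₁⟩ : HeartCat tB) := fun h =>
    config.not_isZero_shift_obj hX 1 (tB.heart.ι.map_isZero h)
  have hY' : ¬ IsZero (⟨_, hY₀⟩ : HeartCat tB) := fun h =>
    config.not_isZero_shift_obj hY 0 (tB.heart.ι.map_isZero h)
  filter_upwards [config.lt_phase, config.phase_lt, config.eventually_exists_polar_obj hX,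
    config.eventually_exists_polar_obj hY, config.stabilityFunction_B.2 _ hX',
    config.stabilityFunction_B.2 _ hY'] with v l₁ l₂ ⟨r, s, θ, hr, hs, h₁, h₂, hA, hB⟩
    ⟨r', s', θ', hr', hs', h₁', h₂', hA', hB'⟩ ⟨u, β, hu, hβ, hβ₁, e⟩ ⟨u', β', hu', hβ', hβ₁', e'⟩
  -- For `X` it is `ΦX[1]` that lies in the second heart, so minus the charge of `ΦX` has phase in
  -- `(b, b + 1]`. This puts `θ` at most at `Γ_T⁻¹(b)`, whereas `θ'` lies above it.
  rw [classK_shift_one, map_neg, ConvLaurent.eval_neg, hB] at e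
  rw [classK_shift_zero, hB'] at e'
  have k₁ := (g v).lift_le_of_polar hs hu l₁ l₂ h₁ h₂ hβ hβ₁ e
  have k₂ := (g v).lt_lift_of_polar hs' hu' l₁ l₂ h₁' h₂' hβ' hβ₁' e'
  rw [chargeDet, hA, hA']
  exact planeDet_polar_pos hr hr' (by linarith) (by linarith)

theorem classK_obj_quasiInverse (F : D) : classK (Φ.obj (Ψ.obj F)) = -classK F := by
  obtain ⟨e⟩ := config.Φ_Ψ
  have h : classK (Φ.obj (Ψ.obj F)) = classK (F⟦(-1 : ℤ)⟧) := classK_congr (e.app F)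
  rw [h, classK_shift_neg_one]

theorem inKer_of_quasiInverse {F : HeartCat tB} (h : ZA (classK (Ψ.obj F.obj)) = 0) :
    InKer tB ZB F := by
  have h' := config.central_charges (Ψ.obj F.obj)
  rw [h, ConvLaurent.toColumn_zero, Matrix.mulVec_zero, config.classK_obj_quasiInverse, map_neg,
    ← ConvLaurent.toColumn_zero] at h'
  exact neg_eq_zero.1 (ConvLaurent.toColumn_injective h')

/-- Since `ΦΨ` is the shift by `-1`, both charges change sign; the signs cancel in the determinant,
and the factor `d` is `det T(v)`. -/
theorem eventually_chargeDet_quasiInverse (F G : D) : ∀ᶠ v in atTop, ∃ d : ℝ, 0 < d ∧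
    chargeDet ZB F G v = d * chargeDet ZA (Ψ.obj F) (Ψ.obj G) v := by
  filter_upwards [config.isGLlPlus, eventually_complexColumn_eval (config.central_charges (Ψ.obj F)),
    eventually_complexColumn_eval (config.central_charges (Ψ.obj G))] with v hv hF hG
  refine ⟨_, hv, ?_⟩
  rw [chargeDet, chargeDet, ← planeDet_of_mulVec hF hG, config.classK_obj_quasiInverse,
    config.classK_obj_quasiInverse, map_neg, map_neg, ConvLaurent.eval_neg, ConvLaurent.eval_neg]
  simp [planeDet]

variable [IsTriangulated C]

/-- A short exact sequence `0 → M → Φ(E) → N → 0` in the second heart induces a short exact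
sequence `0 → P → E → Q → 0` in the first one. -/
theorem exists_shortExact_of_WIT₀ {E : HeartCat tA} (hE : ¬ InKer tA ZA E)
    (hW : IsWIT Φ tB 0 E.obj) {M N : HeartCat tB}
    (H : HasDistTriang (Ψ.obj M.obj) (E.obj⟦(-1 : ℤ)⟧) (Ψ.obj N.obj)) :
    ∃ (P Q U V : HeartCat tA) (p : P ⟶ E) (q : E ⟶ Q) (w : p ≫ q = 0),
      (ShortComplex.mk p q w).ShortExact ∧ IsWIT Φ tB 1 U.obj ∧ IsWIT Φ tB 0 V.obj ∧
      (∀ᶠ v in atTop, chargeDet ZA (Ψ.obj M.obj) (Ψ.obj N.obj) v =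
        chargeDet ZA P.obj Q.obj v + chargeDet ZA U.obj V.obj v) ∧
      (ZA (classK (Ψ.obj M.obj)) ≠ 0 → ZA (classK (Ψ.obj N.obj)) ≠ 0 →
        (¬ InKer tA ZA U ∧ ¬ InKer tA ZA V) ∨ (¬ InKer tA ZA P ∧ ¬ InKer tA ZA Q)) := by
  have := config.isEquivalence_Φ
  obtain ⟨e⟩ := config.Φ_Ψ
  have hM := isGE_isLE_obj_of_quasiInverse config.Φ_heart config.bounded_A e M
  have hN := isGE_isLE_obj_of_quasiInverse config.Φ_heart config.bounded_A e N
  obtain ⟨I, Y₀, Y₁, p, q, w, hpq, hY, hI⟩ :=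
    exists_shortExact_of_hasDistTriang_shift E hM.2 hN.1 hN.2 H
  have hU := (isWIT_of_hasDistTriang config.Φ_heart e N hY).1
  obtain ⟨δ, hδ⟩ := exists_distTriang_of_shortExact hpq
  have cE := congr_arg ZA (HasDistTriang.classK_eq ⟨_, _, _, hδ⟩)
  have cN := congr_arg ZA hY.classK_eq
  have cM := congr_arg ZA hI.classK_eq
  rw [map_add] at cE cN cM
  rw [classK_shift_neg_one, map_neg] at cN cM
  have cM' : ZA (classK (Ψ.obj M.obj)) = -(ZA (classK I.obj) + ZA (classK Y₀.obj)) := by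
    rw [neg_add, cM]; abel
  refine ⟨I, Y₁, Y₀, E, p, q, w, hpq, hU, hW, ?_, fun h₁ h₂ => ?_⟩
  · filter_upwards [ConvLaurent.eventually_eval_add (ZA (classK I.obj)) (ZA (classK Y₀.obj)),
      ConvLaurent.eventually_eval_add (ZA (classK Y₀.obj)) (-ZA (classK Y₁.obj)),
      ConvLaurent.eventually_eval_add (ZA (classK I.obj)) (ZA (classK Y₁.obj))] with v a₁ a₂ a₃
    -- On charges, `-(I + Y₀) ∧ (Y₀ - Y₁) = I ∧ Y₁ + Y₀ ∧ (I + Y₁)`, and `I + Y₁ = E`.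
    simp only [chargeDet, cM', cN, cE, ConvLaurent.eval_neg, a₁, a₂, a₃, planeDet, Complex.add_re,
      Complex.add_im, Complex.neg_re, Complex.neg_im]
    ring
  -- If `Y₀` has zero charge, then `ΨM` and `ΨN` have the charges of `I` and `Y₁` up to sign.
  · by_cases hY₀ : InKer tA ZA Y₀
    · rw [InKer] at hY₀
      rw [hY₀, add_zero] at cM'
      rw [hY₀, zero_add] at cN
      exact Or.inr ⟨fun h => h₁ (by rw [cM', h, neg_zero]), fun h => h₂ (by rw [cN, h, neg_zero])⟩
    · exact Or.inl ⟨hY₀, hE⟩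

/-- A short exact sequence `0 → M → Φ(E)[1] → N → 0` in the second heart induces a short exact
sequence `0 → P → E → Q → 0` in the first one. -/
theorem exists_shortExact_of_WIT₁ {E : HeartCat tA} (hE : ¬ InKer tA ZA E)
    (hW : IsWIT Φ tB 1 E.obj) {M N : HeartCat tB}
    (H : HasDistTriang (Ψ.obj M.obj) E.obj (Ψ.obj N.obj)) :
    ∃ (P Q U V : HeartCat tA) (p : P ⟶ E) (q : E ⟶ Q) (w : p ≫ q = 0),
      (ShortComplex.mk p q w).ShortExact ∧ IsWIT Φ tB 1 U.obj ∧ IsWIT Φ tB 0 V.obj ∧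
      (∀ᶠ v in atTop, chargeDet ZA (Ψ.obj M.obj) (Ψ.obj N.obj) v =
        chargeDet ZA P.obj Q.obj v + chargeDet ZA U.obj V.obj v) ∧
      (ZA (classK (Ψ.obj M.obj)) ≠ 0 → ZA (classK (Ψ.obj N.obj)) ≠ 0 →
        (¬ InKer tA ZA U ∧ ¬ InKer tA ZA V) ∨ (¬ InKer tA ZA P ∧ ¬ InKer tA ZA Q)) := by
  have := config.isEquivalence_Φ
  obtain ⟨e⟩ := config.Φ_Ψ
  have hM := isGE_isLE_obj_of_quasiInverse config.Φ_heart config.bounded_A e M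
  have hN := isGE_isLE_obj_of_quasiInverse config.Φ_heart config.bounded_A e N
  obtain ⟨X₀, X₁, J, p, q, w, hpq, hX, hJ⟩ :=
    exists_shortExact_of_hasDistTriang E hM.1 hM.2 hN.1 H
  have hV := (isWIT_of_hasDistTriang config.Φ_heart e M hX).2
  obtain ⟨δ, hδ⟩ := exists_distTriang_of_shortExact hpq
  have cE := congr_arg ZA (HasDistTriang.classK_eq ⟨_, _, _, hδ⟩)
  have cM := congr_arg ZA hX.classK_eq
  have cN := congr_arg ZA hJ.classK_eq
  rw [map_add] at cE cN cM
  rw [classK_shift_neg_one, map_neg] at cN cM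
  have cN' : ZA (classK (Ψ.obj N.obj)) = ZA (classK J.obj) + ZA (classK X₁.obj) := by
    rw [cN]; abel
  refine ⟨X₀, J, E, X₁, p, q, w, hpq, hW, hV, ?_, fun h₁ h₂ => ?_⟩
  · filter_upwards [ConvLaurent.eventually_eval_add (ZA (classK X₀.obj)) (-ZA (classK X₁.obj)),
      ConvLaurent.eventually_eval_add (ZA (classK J.obj)) (ZA (classK X₁.obj)),
      ConvLaurent.eventually_eval_add (ZA (classK X₀.obj)) (ZA (classK J.obj))] with v a₁ a₂ a₃
    -- On charges, `(X₀ - X₁) ∧ (J + X₁) = X₀ ∧ J + (X₀ + J) ∧ X₁`, and `X₀ + J = E`.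
    simp only [chargeDet, cM, cN', cE, ConvLaurent.eval_neg, a₁, a₂, a₃, planeDet, Complex.add_re,
      Complex.add_im, Complex.neg_re, Complex.neg_im]
    ring
  · by_cases hX₁ : InKer tA ZA X₁
    · rw [InKer] at hX₁
      rw [hX₁, neg_zero, add_zero] at cM
      rw [hX₁, add_zero] at cN'
      exact Or.inr ⟨fun h => h₁ (by rw [cM, h]), fun h => h₂ (by rw [cN', h])⟩
    · exact Or.inl ⟨hE, hX₁⟩

variable [IsTriangulated D]

/-- Both WIT cases at once: `Ψ` sends `ΦE[i]` to `E[-1]` for `i = 0` and to `E` for `i = 1`. -/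
theorem exists_shortExact_of_shortExact {E : HeartCat tA} (hE : ¬ InKer tA ZA E)
    {i : ℤ} (hi : i = 0 ∨ i = 1) (hW : IsWIT Φ tB i E.obj) {M N : HeartCat tB}
    {f : M ⟶ ⟨(Φ.obj E.obj)⟦i⟧, hW⟩} {h : (⟨(Φ.obj E.obj)⟦i⟧, hW⟩ : HeartCat tB) ⟶ N}
    {w' : f ≫ h = 0} (H : (ShortComplex.mk f h w').ShortExact) :
    ∃ (P Q U V : HeartCat tA) (p : P ⟶ E) (q : E ⟶ Q) (w : p ≫ q = 0),
      (ShortComplex.mk p q w).ShortExact ∧ IsWIT Φ tB 1 U.obj ∧ IsWIT Φ tB 0 V.obj ∧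
      (∀ᶠ v in atTop, chargeDet ZA (Ψ.obj M.obj) (Ψ.obj N.obj) v =
        chargeDet ZA P.obj Q.obj v + chargeDet ZA U.obj V.obj v) ∧
      (ZA (classK (Ψ.obj M.obj)) ≠ 0 → ZA (classK (Ψ.obj N.obj)) ≠ 0 →
        (¬ InKer tA ZA U ∧ ¬ InKer tA ZA V) ∨ (¬ InKer tA ZA P ∧ ¬ InKer tA ZA Q)) := by
  obtain ⟨δ, hδ⟩ := exists_distTriang_of_shortExact H
  have K : HasDistTriang (Ψ.obj M.obj) (Ψ.obj ((Φ.obj E.obj)⟦i⟧)) (Ψ.obj N.obj) :=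
    HasDistTriang.map (X := M.obj) (Y := (Φ.obj E.obj)⟦i⟧) (Z := N.obj) ⟨_, _, _, hδ⟩ Ψ
  obtain ⟨e⟩ := config.Ψ_Φ
  have e₁ : Ψ.obj ((Φ.obj E.obj)⟦i⟧) ≅ E.obj⟦(-1 : ℤ)⟧⟦i⟧ :=
    (Ψ.commShiftIso i).app (Φ.obj E.obj) ≪≫ (shiftFunctor C i).mapIso (e.app E.obj)
  rcases hi with rfl | rfl
  · exact config.exists_shortExact_of_WIT₀ hE hW (K.of_iso (Iso.refl _)
      (e₁ ≪≫ (shiftFunctorZero C ℤ).app _) (Iso.refl _))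
  · exact config.exists_shortExact_of_WIT₁ hE hW (K.of_iso (Iso.refl _)
      (e₁ ≪≫ (shiftEquiv C (1 : ℤ)).counitIso.app _) (Iso.refl _))

end ConfigurationIIIw

end Configuration

end

/-! ### Preservation of semistability and stability -/

theorem mainTheorem10
    {C : Type*} [Category* C] [HasZeroObject C] [HasShift C ℤ] [Preadditive C]
    [∀ n : ℤ, (shiftFunctor C n).Additive] [Pretriangulated C] [IsTriangulated C]
    {D : Type*} [Category* D] [HasZeroObject D] [HasShift D ℤ] [Preadditive D]
    [∀ n : ℤ, (shiftFunctor D n).Additive] [Pretriangulated D] [IsTriangulated D]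
    (Φ : C ⥤ D) (Ψ : D ⥤ C) [Φ.CommShift ℤ] [Φ.IsTriangulated] [Ψ.CommShift ℤ] [Ψ.IsTriangulated]
    (a b : ℝ → ℝ)
    (σA : WeakPolynomialStabilityData C a) (σB : WeakPolynomialStabilityData D b)
    (T : GL (Fin 2) (ConvLaurent ℝ)) (g : ℝ → GLTilde)
    (config : ConfigurationIIIw Φ Ψ σA.t σB.t a b σA.Z σB.Z T g)
    (E : HeartCat σA.t) (hE : ¬ InKer σA.t σA.Z E)
    (i : ℤ) (hi : i = 0 ∨ i = 1) (hWIT : IsWIT Φ σB.t i E.obj) :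
    ((∀ (M N : HeartCat σB.t) (p : M ⟶ ⟨(Φ.obj E.obj)⟦i⟧, hWIT⟩)
          (q : (⟨(Φ.obj E.obj)⟦i⟧, hWIT⟩ : HeartCat σB.t) ⟶ N) (w : p ≫ q = 0),
        (ShortComplex.mk p q w).ShortExact → ¬ IsZero M → ¬ IsZero N →
          InKer σB.t σB.Z M ∨ InKer σB.t σB.Z N → PhaseLE (σB.phase M) (σB.phase N)) →
      σA.IsSemistable E → σB.IsSemistableObj (Φ.obj E.obj)) ∧
    ((∀ (M N : HeartCat σB.t) (p : M ⟶ ⟨(Φ.obj E.obj)⟦i⟧, hWIT⟩)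
          (q : (⟨(Φ.obj E.obj)⟦i⟧, hWIT⟩ : HeartCat σB.t) ⟶ N) (w : p ≫ q = 0),
        (ShortComplex.mk p q w).ShortExact → ¬ IsZero M → ¬ IsZero N →
          InKer σB.t σB.Z M ∨ InKer σB.t σB.Z N → PhaseLT (σB.phase M) (σB.phase N)) →
      σA.IsStable E → σB.IsStableObj (Φ.obj E.obj)) := by
  have nonneg : σA.IsSemistable E → ∀ {P Q U V : HeartCat σA.t} {p : P ⟶ E} {q : E ⟶ Q}
      {w : p ≫ q = 0}, (ShortComplex.mk p q w).ShortExact → IsWIT Φ σB.t 1 U.obj →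
      IsWIT Φ σB.t 0 V.obj → (∀ᶠ v in atTop, 0 ≤ chargeDet σA.Z P.obj Q.obj v) ∧
        ∀ᶠ v in atTop, 0 ≤ chargeDet σA.Z U.obj V.obj v := by
    intro hss P Q U V p q w hpq hU hV
    refine ⟨hss.eventually_chargeDet_nonneg hpq, ?_⟩
    by_cases hU' : InKer σA.t σA.Z U
    · exact Eventually.of_forall fun v => (chargeDet_eq_zero_left hU' _ v).ge
    by_cases hV' : InKer σA.t σA.Z V
    · exact Eventually.of_forall fun v => (chargeDet_eq_zero_right _ hV' v).ge
    exact (config.eventually_chargeDet_pos hU' hV' hU hV).mono fun _ => le_of_lt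
  have hne : ¬ IsZero (⟨(Φ.obj E.obj)⟦i⟧, hWIT⟩ : HeartCat σB.t) := fun h =>
    config.not_isZero_shift_obj hE i (σB.t.heart.ι.map_isZero h)
  refine ⟨fun hker hss => ⟨i, hWIT, hne, fun M N f h w' H hM hN => ?_⟩,
    fun hker hs => ⟨i, hWIT, hne, fun M N f h w' H hM hN => ?_⟩⟩
  all_goals
    by_cases hk : InKer σB.t σB.Z M ∨ InKer σB.t σB.Z N
    · exact hker M N f h w' H hM hN hk
    obtain ⟨hM', hN'⟩ := not_or.1 hk
    obtain ⟨P, Q, U, V, p, q, w, hpq, hU, hV, hdet, hcase⟩ :=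
      config.exists_shortExact_of_shortExact hE hi hWIT H
  · rw [σB.phaseLE_iff hM' hN']
    filter_upwards [hdet, nonneg hss hpq hU hV |>.1, nonneg hss hpq hU hV |>.2,
      config.eventually_chargeDet_quasiInverse M.obj N.obj] with v h₁ h₂ h₃ ⟨d, hd, h₄⟩
    rw [h₄, h₁]
    positivity
  · rw [σB.phaseLT_iff hM' hN']
    -- Both summands are nonnegative, and strictness comes from the second if `U` and `V` have
    -- nonzero charge, or from stability of `E` if `P` and `Q` do.
    have hpos : ∀ᶠ v in atTop,
        0 < chargeDet σA.Z P.obj Q.obj v + chargeDet σA.Z U.obj V.obj v := by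
      rcases hcase (fun h => hM' (config.inKer_of_quasiInverse h))
        (fun h => hN' (config.inKer_of_quasiInverse h)) with ⟨k₁, k₂⟩ | ⟨k₁, k₂⟩
      · filter_upwards [nonneg hs.isSemistable hpq hU hV |>.1,
          config.eventually_chargeDet_pos k₁ k₂ hU hV] with v h₁ h₂ using by linarith
      · filter_upwards [nonneg hs.isSemistable hpq hU hV |>.2,
          hs.eventually_chargeDet_pos hpq k₁ k₂] with v h₁ h₂ using by linarith
    filter_upwards [hdet, hpos, config.eventually_chargeDet_quasiInverse M.obj N.obj] with v h₁ h₂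
      ⟨d, hd, h₄⟩
    rw [h₄, h₁]
    positivity
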